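/- **Setting.** Let $d\ge 1$ (in applications $d=2,3$), $\nu>0$, $\alpha>0$, and $p_t,p_s\ge 0$ integers. Let $\Omega(t)\subset\mathbb R^d$, $t\in[t_0,t_N]$, be bounded open sets (e.g. polygons or polyhedra) depending continuously on $t$, in the sense that $\mathcal E=\{(t,x):t_0<t<t_N,\ x\in\Omega(t)\}$ is open in $\mathbb R^{d+1}$ with closure $\{(t,x):t_0\le t\le t_N,\ x\in\overline{\Omega(t)}\}$. Let $\Gamma_D(t)\subset\partial\Omega(t)$, $\partial\mathcal E_D=\{(t,x):t_0<t\le t_N,\ x\in\Gamma_D(t)\}$ and $\partial\mathcal E_N=\partial\mathcal E\setminus\partial\mathcal E_D$. Let $\beta=(1,\bar\beta)$ with $\bar\beta\in L^\infty(\mathcal E)^d$, $\nabla\cdot\beta\in L^\infty(\mathcal E)$, where $\nabla=(\partial_t,\overline\nabla)$; $\beta\cdot n$ denotes the (weak) normal trace and $\beta_n=|\beta\cdot n|$. **Mesh.** Let $t_n=t_0+n\Delta t$, $\Delta t=(t_N-t_0)/N$. In each slab $\mathcal E\cap\{t_n<t<t_{n+1}\}$ there are finitely many disjoint open elements $\mathcal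 K\subset\mathcal E$ whose closures fill the closure of the slab; $\mathcal T_h$ is the set of all elements. Each $\mathcal K$ is $\phi_{\mathcal K}(\widetilde{\mathcal K})$, where $\widetilde{\mathcal K}=F_{\mathcal K}((-1,1)^{d+1})$, $F_{\mathcal K}(\hat x)=\mathrm{diag}(\tfrac{\Delta t}2,\tfrac{h_1}2,\dots,\tfrac{h_d}2)\hat x+b$, is a brick with time interval $(t_n,t_{n+1})$, and $\phi_{\mathcal K}$ is a diffeomorphism, $C^1$ up to the boundary, that preserves the time coordinate. The Jacobians satisfy $C_1^{-1}\le|\det J_{\phi_{\mathcal K}}|\le C_1$ on $\widetilde{\mathcal K}$ and all first minors of $J_{\phi_{\mathcal K}}$ are bounded by $C_2$ in absolute value. Let $h_K$ and $\rho_K$ be the radii of the circumscribed and inscribed spheres of the brick $h_1\times\dots\times h_d$; assume $h_K/\rho_K\le c_r$ for all $\mathcal K$. Let $n=(n_t,\bar n)$ be the outward unit normal on $\partial\mathcal K$, $\mathcal Q\subset\partial\mathcal K$ the lateral part $t_n<t<t_{n+1}$ of $\partial\mathcal K$, $\partial\mathcal K^+=\{\beta\cdot n>0\}$, $\partial\mathcal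 K^-=\{\beta\cdot n\le 0\}$, and let $\Gamma$ be the union of all facets (the sets shared by two elements, and the element faces on $\partial\mathcal E$). **Spaces.** Let $Q_{(p_t,p_s)}$ be the tensor-product polynomials of degree $\le p_t$ in time and $\le p_s$ in each spatial variable. $V_h$ is the set of $v_h\in L^2(\mathcal E)$ with $v_h|_{\mathcal K}\circ\phi_{\mathcal K}\circ F_{\mathcal K}\in Q_{(p_t,p_s)}$ for all $\mathcal K$; $M_h$ is the set of $\mu_h\in L^2(\Gamma)$ that on each facet are, after pull-back by $\phi_{\mathcal K}\circ F_{\mathcal K}$ for an adjacent $\mathcal K$, restrictions of elements of $Q_{(p_t,p_s)}$, and that vanish on $\partial\mathcal E_D$. Put $V_h^\star=V_h\times M_h$, $V(h)=V_h+H^2(\mathcal E)$, $M(h)=M_h+H^{3/2}(\Gamma)$, $V^\star(h)=V(h)\times M(h)$, where $H^{3/2}(\Gamma)$ is the space of traces $\gamma(w)$ on $\Gamma$ of $w\in H^2(\mathcal E)$. Derivatives of $u\in V(h)$ are taken elementwise ($\nabla_h$, $\overline\nabla_h$), and values of $u$, $\overline\nabla_h u$ on $\partial\mathcal K$ are traces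 from inside $\mathcal K$. **Form.** $a_h=a_h^a+a_h^d$ with $$a_h^a((u,\lambda),(v,\mu))=-\sum_{\mathcal K}\int_{\mathcal K}\beta u\cdot\nabla_h v\,dx+\int_{\partial\mathcal E_N}\tfrac12(\beta\cdot n+|\beta\cdot n|)\lambda\mu\,ds+\sum_{\mathcal K}\int_{\partial\mathcal K}\tfrac12\big(\beta\cdot n(u+\lambda)+|\beta\cdot n|(u-\lambda)\big)(v-\mu)\,ds,$$ $$a_h^d((u,\lambda),(v,\mu))=\sum_{\mathcal K}\int_{\mathcal K}\nu\overline\nabla_hu\cdot\overline\nabla_hv\,dx+\sum_{\mathcal K}\int_{\mathcal Q}\tfrac{\nu\alpha}{h_K}(u-\lambda)(v-\mu)\,ds-\sum_{\mathcal K}\int_{\mathcal Q}\big[\nu(u-\lambda)\overline\nabla_hv\cdot\bar n+\nu\overline\nabla_hu\cdot\bar n(v-\mu)\big]ds.$$ **Norms.** $$|||(v,\mu)|||_v^2=\|v\|_{\mathcal E}^2+\|\beta_n^{1/2}\mu\|_{\partial\mathcal E_N}^2+\sum_{\mathcal K}\|\beta_n^{1/2}(v-\mu)\|_{\partial\mathcal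 K}^2+\sum_{\mathcal K}\nu\|\overline\nabla_hv\|_{\mathcal K}^2+\sum_{\mathcal K}\tfrac{\nu}{h_K}\|v-\mu\|_{\mathcal Q}^2,$$ $$|||(v,\mu)|||_s^2=|||(v,\mu)|||_v^2+\sum_{\mathcal K}\tfrac{\Delta t\,h_K^2}{\Delta t+h_K}\|\partial_tv\|_{\mathcal K}^2,$$ $$|||(v,\mu)|||_{s,\star}^2=|||(v,\mu)|||_s^2+\sum_{\mathcal K}\|\beta_n^{1/2}v\|_{\partial\mathcal K^+}^2+\sum_{\mathcal K}\|\beta_n^{1/2}\mu\|_{\partial\mathcal K^-}^2+\sum_{\mathcal K}h_K\nu\|\overline\nabla_hv\cdot\bar n\|_{\mathcal Q}^2+\sum_{\mathcal K}\tfrac{\Delta t+h_K}{\Delta t\,h_K^2}\|v\|_{\mathcal K}^2.$$ **Lemma (Boundedness).** For all $d,p_t,p_s,\nu,\alpha$ as above and all real $B,c_r,C_1,C_2$ there is $c_B>0$, depending only on $d,p_t,p_s,\nu,\alpha,B,c_r,C_1,C_2$ (in particular independent of $h_K$ and $\Delta t$), such that for every domain, every $\beta$ with $\|\bar\beta\|_{L^\infty(\mathcal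 E)}\le B$, and every mesh as above, $$|a_h(\boldsymbol u,(v_h,\mu_h))|\le c_B\,|||\boldsymbol u|||_{s,\star}\,|||(v_h,\mu_h)|||_s\qquad\text{for all }\boldsymbol u=(u,\lambda)\in V^\star(h)\text{ and all }(v_h,\mu_h)\in V_h^\star ;$$ in particular this holds for all $\boldsymbol u=(u,\gamma(u))\in V^\star(h)$. -/

import Mathlib

open MeasureTheory Set Filter Topology
open scoped ContDiff

namespace STHDG

/-! ### Space-time points

A point of space-time is `z = (t, x)` with `t = z 0` and `x = spatial z`. -/

/-- Space-time `ℝ^{d+1}`; coordinate `0` is the time. -/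
abbrev SpaceTime (d : ℕ) : Type := EuclideanSpace ℝ (Fin (d + 1))

/-- Spatial part of a space-time vector. -/
noncomputable def spatial {d : ℕ} (z : SpaceTime d) : EuclideanSpace ℝ (Fin d) :=
  WithLp.toLp 2 (fun i : Fin d => z i.succ)

/-- The space-time vector with given temporal and spatial parts. -/
noncomputable def mkST {d : ℕ} (t : ℝ) (x : EuclideanSpace ℝ (Fin d)) : SpaceTime d :=
  WithLp.toLp 2 (Fin.cons t (fun i : Fin d => x i))

/-- `j`-th coordinate vector of space-time. -/
noncomputable def basisVec {d : ℕ} (j : Fin (d + 1)) : SpaceTime d :=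
  EuclideanSpace.single j (1 : ℝ)

/-- Surface measure on `d`-dimensional hypersurfaces of `ℝ^{d+1}`: the `d`-dimensional Hausdorff
measure, normalised to agree with `d`-dimensional Lebesgue measure on hyperplanes. -/
noncomputable def surf (d : ℕ) : Measure (SpaceTime d) :=
  Measure.euclideanHausdorffMeasure d

/-! ### Weak derivatives, traces, normals

Each of the following objects is specified by a predicate that determines it almost everywhere;
the operators `weakGrad`, `trace`, `outerNormal` and `normalTrace` then pick a representative. -/

/-- `u ∈ L²(U)` has the weak (space-time) gradient `g ∈ L²(U)`. -/
def IsWeakGrad {d : ℕ} (U : Set (SpaceTime d)) (u : SpaceTime d → ℝ)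
    (g : SpaceTime d → SpaceTime d) : Prop :=
  MemLp u 2 (volume.restrict U) ∧ MemLp g 2 (volume.restrict U) ∧
    ∀ ψ : SpaceTime d → ℝ, ContDiff ℝ ∞ ψ → HasCompactSupport ψ → tsupport ψ ⊆ U →
      ∀ j : Fin (d + 1),
        ∫ z in U, u z * fderiv ℝ ψ z (basisVec j) = -∫ z in U, g z j * ψ z

open Classical in
/-- The weak gradient of `u` on `U`. -/
noncomputable def weakGrad {d : ℕ} (U : Set (SpaceTime d)) (u : SpaceTime d → ℝ) :
    SpaceTime d → SpaceTime d :=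
  if h : ∃ g, IsWeakGrad U u g then h.choose else 0

/-- The Sobolev space `H²(U)`: `u`, its first and its second weak derivatives are in `L²(U)`. -/
def MemH2 {d : ℕ} (U : Set (SpaceTime d)) (u : SpaceTime d → ℝ) : Prop :=
  ∃ g, IsWeakGrad U u g ∧ ∀ j : Fin (d + 1), ∃ g', IsWeakGrad U (fun z => g z j) g'

/-- `g ∈ L²(∂U)` is the trace on `∂U` of the function `w ∈ L²(U)`: for almost every `z ∈ ∂U`, the
mean of `‖w - g z‖` over `U ∩ B(z, r)` tends to `0` as `r → 0`. On a bounded Lipschitz open set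
every `w ∈ H¹(U)` has such a trace, equal almost everywhere to its Sobolev trace, and a function
that is continuous on the closure has its boundary values as trace. -/
def IsTrace {d : ℕ} {F : Type*} [NormedAddCommGroup F] [NormedSpace ℝ F]
    (U : Set (SpaceTime d)) (w g : SpaceTime d → F) : Prop :=
  MemLp w 2 (volume.restrict U) ∧ MemLp g 2 ((surf d).restrict (frontier U)) ∧
    ∀ᵐ z ∂((surf d).restrict (frontier U)),
      Tendsto (fun r : ℝ => ⨍ y in U ∩ Metric.ball z r, ‖w y - g z‖) (𝓝[>] 0) (𝓝 0)

open Classical in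
/-- The trace of `w` on `∂U`. -/
noncomputable def trace {d : ℕ} {F : Type*} [NormedAddCommGroup F] [NormedSpace ℝ F]
    (U : Set (SpaceTime d)) (w : SpaceTime d → F) : SpaceTime d → F :=
  if h : ∃ g, IsTrace U w g then h.choose else 0

/-- `n` is the outward unit normal field on `∂U`, in the sense of the Gauss-Green formula. -/
def IsOuterNormal {d : ℕ} (U : Set (SpaceTime d)) (n : SpaceTime d → SpaceTime d) : Prop :=
  AEStronglyMeasurable n ((surf d).restrict (frontier U)) ∧
    (∀ᵐ z ∂((surf d).restrict (frontier U)), ‖n z‖ = 1) ∧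
    ∀ ψ : SpaceTime d → ℝ, ContDiff ℝ ∞ ψ → HasCompactSupport ψ → ∀ j : Fin (d + 1),
      ∫ z in U, fderiv ℝ ψ z (basisVec j) = ∫ z in frontier U, ψ z * n z j ∂(surf d)

open Classical in
/-- The outward unit normal field on `∂U`. -/
noncomputable def outerNormal {d : ℕ} (U : Set (SpaceTime d)) : SpaceTime d → SpaceTime d :=
  if h : ∃ n, IsOuterNormal U n then h.choose else 0

/-- `q ∈ L^∞(U)` is the weak divergence on `U` of the vector field `β`. -/
def IsWeakDiv {d : ℕ} (U : Set (SpaceTime d)) (β : SpaceTime d → SpaceTime d)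
    (q : SpaceTime d → ℝ) : Prop :=
  MemLp q ⊤ (volume.restrict U) ∧
    ∀ ψ : SpaceTime d → ℝ, ContDiff ℝ ∞ ψ → HasCompactSupport ψ → tsupport ψ ⊆ U →
      ∫ z in U, fderiv ℝ ψ z (β z) = -∫ z in U, q z * ψ z

/-- `b ∈ L^∞(∂U)` is the normal trace `β · n` on `∂U` of a field `β` with `β, ∇·β ∈ L^∞(U)`:
`∫_U β · ∇ψ + ∫_U (∇·β) ψ = ∫_{∂U} b ψ` for all test functions `ψ` on the whole space. If `β` is
continuous up to `∂U` this is the pointwise product of `β` with the outward unit normal. -/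
def IsNormalTrace {d : ℕ} (U : Set (SpaceTime d)) (β : SpaceTime d → SpaceTime d)
    (b : SpaceTime d → ℝ) : Prop :=
  MemLp b ⊤ ((surf d).restrict (frontier U)) ∧
    ∃ q, IsWeakDiv U β q ∧
      ∀ ψ : SpaceTime d → ℝ, ContDiff ℝ ∞ ψ → HasCompactSupport ψ →
        (∫ z in U, fderiv ℝ ψ z (β z)) + ∫ z in U, q z * ψ z
          = ∫ z in frontier U, b z * ψ z ∂(surf d)

open Classical in
/-- The normal component `β · n` on `∂U`. -/
noncomputable def normalTrace {d : ℕ} (U : Set (SpaceTime d)) (β : SpaceTime d → SpaceTime d) :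
    SpaceTime d → ℝ :=
  if h : ∃ b, IsNormalTrace U β b then h.choose else 0

/-! ### The space-time domain -/

/-- A time-dependent open set `Ω(t)`, `t₀ ≤ t ≤ t_N`, with the Dirichlet part `Γ_D(t)` of its
boundary. Continuous dependence on time is used in the form that
`{(t, x) : t₀ < t < t_N, x ∈ Ω(t)}` is open with closure
`{(t, x) : t₀ ≤ t ≤ t_N, x ∈ closure Ω(t)}`. -/
structure Domain (d : ℕ) where
  /-- initial time -/
  t₀ : ℝ
  /-- final time -/
  tN : ℝ
  lt : t₀ < tN
  /-- the spatial domain at time `t` -/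
  Ω : ℝ → Set (EuclideanSpace ℝ (Fin d))
  /-- the Dirichlet part of the boundary of `Ω t` -/
  ΓD : ℝ → Set (EuclideanSpace ℝ (Fin d))
  isOpen_Ω : ∀ t ∈ Icc t₀ tN, IsOpen (Ω t)
  ΓD_subset : ∀ t ∈ Icc t₀ tN, ΓD t ⊆ frontier (Ω t)
  isOpen_tube : IsOpen {z : SpaceTime d | z 0 ∈ Ioo t₀ tN ∧ spatial z ∈ Ω (z 0)}
  closure_tube : closure {z : SpaceTime d | z 0 ∈ Ioo t₀ tN ∧ spatial z ∈ Ω (z 0)}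
    = {z : SpaceTime d | z 0 ∈ Icc t₀ tN ∧ spatial z ∈ closure (Ω (z 0))}
  measurable_dirichlet :
    MeasurableSet {z : SpaceTime d | z 0 ∈ Ioc t₀ tN ∧ spatial z ∈ ΓD (z 0)}

/-- The space-time domain `ℰ`. -/
def Domain.E {d : ℕ} (D : Domain d) : Set (SpaceTime d) :=
  {z | z 0 ∈ Ioo D.t₀ D.tN ∧ spatial z ∈ D.Ω (z 0)}

/-- The Dirichlet boundary `∂ℰ_D`. -/
def Domain.bdryD {d : ℕ} (D : Domain d) : Set (SpaceTime d) :=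
  {z | z 0 ∈ Ioc D.t₀ D.tN ∧ spatial z ∈ D.ΓD (z 0)}

/-- The mixed boundary `∂ℰ_N`, the rest of `∂ℰ`; it contains `Ω(t₀)` and `Ω(t_N)`. -/
def Domain.bdryN {d : ℕ} (D : Domain d) : Set (SpaceTime d) :=
  frontier D.E \ D.bdryD

/-! ### Space-time elements -/

/-- The master element `(-1, 1)^{d+1}`. -/
def refCube (d : ℕ) : Set (SpaceTime d) := {y | ∀ j, y j ∈ Ioo (-1 : ℝ) 1}

/-- The closed master element. -/
def refCubeClosed (d : ℕ) : Set (SpaceTime d) := {y | ∀ j, y j ∈ Icc (-1 : ℝ) 1}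

/-- The affine map `ŷ ↦ diag(Δt/2, h₁/2, …, h_d/2) ŷ + b`. -/
noncomputable def affineMap {d : ℕ} (Δt : ℝ) (h : Fin d → ℝ) (b y : SpaceTime d) : SpaceTime d :=
  WithLp.toLp 2 (fun j : Fin (d + 1) =>
    (Fin.cons (Δt / 2) (fun i : Fin d => h i / 2) : Fin (d + 1) → ℝ) j * y j + b j)

/-- A space-time element in the time slab `(tn, tn + Δt)`: the image of the brick
`(tn, tn + Δt) × (h₁ × ⋯ × h_d)` under a diffeomorphism `φ` that is `C¹` up to the boundary and
keeps the time coordinate. (A `C¹` map on the closed brick extends to a `C¹` map of the whole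
space, so nothing is lost by letting `φ` be defined everywhere; only its values on the closed brick
matter. Linear interpolation in time between two spatial elements is a special case.) -/
structure Element (d : ℕ) (Δt : ℝ) where
  /-- start of the time slab -/
  tn : ℝ
  /-- spatial edge lengths of the brick -/
  h : Fin d → ℝ
  h_pos : ∀ i, 0 < h i
  /-- centre of the brick -/
  b : SpaceTime d
  b_time : b 0 = tn + Δt / 2
  /-- the map from the brick to the element -/
  φ : SpaceTime d → SpaceTime d
  contDiff : ContDiff ℝ 1 φ
  injOn : InjOn φ (affineMap Δt h b '' refCubeClosed d)
  det_ne_zero : ∀ y ∈ affineMap Δt h b '' refCubeClosed d, (fderiv ℝ φ y).det ≠ 0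
  time_eq : ∀ y ∈ affineMap Δt h b '' refCubeClosed d, φ y 0 = y 0

namespace Element

variable {d : ℕ} {Δt : ℝ}

/-- The intermediate brick-shaped element. -/
def brick (K : Element d Δt) : Set (SpaceTime d) := affineMap Δt K.h K.b '' refCube d

/-- The composed map from the master element. -/
noncomputable def Φ (K : Element d Δt) (y : SpaceTime d) : SpaceTime d :=
  K.φ (affineMap Δt K.h K.b y)

/-- The (open) element as a set. -/
def carrier (K : Element d Δt) : Set (SpaceTime d) := K.φ '' K.brick

/-- The Jacobian matrix of `φ`. -/
noncomputable def jac (K : Element d Δt) (z : SpaceTime d) :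
    Matrix (Fin (d + 1)) (Fin (d + 1)) ℝ :=
  Matrix.of fun m n => fderiv ℝ K.φ z (basisVec n) m

/-- Radius `h_K` of the circumscribed sphere of the spatial brick. -/
noncomputable def hK (K : Element d Δt) : ℝ := Real.sqrt (∑ i, K.h i ^ 2) / 2

/-- Radius `ρ_K` of the inscribed sphere of the spatial brick. -/
noncomputable def rhoK (K : Element d Δt) : ℝ := (⨅ i, K.h i) / 2

/-- The lateral boundary `𝒬 = ∂𝒦 \ (Kⁿ ∪ Kⁿ⁺¹)`: the bottom `Kⁿ` and the top `Kⁿ⁺¹` are the parts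
of `∂𝒦` at the two ends of the time slab. -/
def Q (K : Element d Δt) : Set (SpaceTime d) :=
  frontier K.carrier ∩ {z | z 0 ∈ Ioo K.tn (K.tn + Δt)}

/-- `S` is one of the `2(d+1)` closed faces of the element. -/
def IsFace (K : Element d Δt) (S : Set (SpaceTime d)) : Prop :=
  ∃ (j : Fin (d + 1)) (s : ℝ), (s = 1 ∨ s = -1) ∧ S = K.Φ '' {y ∈ refCubeClosed d | y j = s}

end Element

/-! ### The mesh -/

/-- A space-time mesh of `ℰ` with `N` slabs of equal length. Within a slab the finitely many
elements are disjoint and their closures fill the closure of the slab. -/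
structure Mesh {d : ℕ} (D : Domain d) where
  /-- number of time slabs -/
  N : ℕ
  N_pos : 0 < N
  /-- number of elements -/
  numElem : ℕ
  /-- the elements -/
  K : Fin numElem → Element d ((D.tN - D.t₀) / N)
  /-- the slab that an element belongs to -/
  slab : Fin numElem → Fin N
  tn_eq : ∀ k, (K k).tn = D.t₀ + (slab k : ℕ) * ((D.tN - D.t₀) / N)
  subset : ∀ k, (K k).carrier ⊆ D.E
  disjoint : Pairwise fun k l => Disjoint (K k).carrier (K l).carrier
  cover : ∀ n : Fin N,
    closure (D.E ∩ {z | z 0 ∈ Ioo (D.t₀ + (n : ℕ) * ((D.tN - D.t₀) / N))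
      (D.t₀ + ((n : ℕ) + 1) * ((D.tN - D.t₀) / N))})
      = ⋃ k ∈ {k | slab k = n}, closure (K k).carrier

namespace Mesh

variable {d : ℕ} {D : Domain d}

/-- The time step. -/
noncomputable def Δt (T : Mesh D) : ℝ := (D.tN - D.t₀) / T.N

/-- Spatial shape regularity with constant `cr`. -/
def ShapeRegular (T : Mesh D) (cr : ℝ) : Prop := ∀ k, (T.K k).hK / (T.K k).rhoK ≤ cr

/-- The bounds on the Jacobians of the maps `φ`, with constants `C₁` and `C₂`. -/
def JacobianBounds (T : Mesh D) (C₁ C₂ : ℝ) : Prop :=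
  ∀ k, ∀ z ∈ (T.K k).brick,
    C₁⁻¹ ≤ |((T.K k).jac z).det| ∧ |((T.K k).jac z).det| ≤ C₁ ∧
    ∀ m n : Fin (d + 1), |(((T.K k).jac z).submatrix m.succAbove n.succAbove).det| ≤ C₂

/-- The union `Γ` of all facets. -/
def skeleton (T : Mesh D) : Set (SpaceTime d) := ⋃ k, frontier (T.K k).carrier

/-- `S` is a facet of the mesh: either shared by two different elements, or a face of an element
that lies on `∂ℰ`. -/
def IsFacet (T : Mesh D) (S : Set (SpaceTime d)) : Prop :=
  (∃ k l S₁ S₂, k ≠ l ∧ (T.K k).IsFace S₁ ∧ (T.K l).IsFace S₂ ∧ S = S₁ ∩ S₂ ∧ 0 < surf d S) ∨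
  (∃ k, (T.K k).IsFace S ∧ S ⊆ frontier D.E)

end Mesh

/-! ### Approximation spaces and extended spaces -/

/-- `Q_{(pt,ps)}`: tensor-product polynomials of degree at most `pt` in time and at most `ps` in
each spatial variable. -/
def IsTensorPoly {d : ℕ} (pt ps : ℕ) (q : MvPolynomial (Fin (d + 1)) ℝ) : Prop :=
  q.degreeOf 0 ≤ pt ∧ ∀ i : Fin d, q.degreeOf i.succ ≤ ps

/-- The discrete element space `V_h^{(pt,ps)}`. -/
def MemVh {d : ℕ} {D : Domain d} (T : Mesh D) (pt ps : ℕ) (v : SpaceTime d → ℝ) : Prop :=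
  MemLp v 2 (volume.restrict D.E) ∧
    ∀ k, ∃ q : MvPolynomial (Fin (d + 1)) ℝ, IsTensorPoly pt ps q ∧
      ∀ᵐ y ∂(volume.restrict (refCube d)),
        v ((T.K k).Φ y) = MvPolynomial.eval (fun j => y j) q

/-- The discrete facet space `M_h^{(pt,ps)}`. On a facet shared by two elements the pull-back may be
taken through either of them. -/
def MemMh {d : ℕ} {D : Domain d} (T : Mesh D) (pt ps : ℕ) (μ : SpaceTime d → ℝ) : Prop :=
  MemLp μ 2 ((surf d).restrict T.skeleton) ∧
    (∀ S, T.IsFacet S → ∃ k S', (T.K k).IsFace S' ∧ S ⊆ S' ∧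
      ∃ q : MvPolynomial (Fin (d + 1)) ℝ, IsTensorPoly pt ps q ∧
        ∀ᵐ z ∂((surf d).restrict S), ∀ y ∈ refCubeClosed d, (T.K k).Φ y = z →
          μ z = MvPolynomial.eval (fun j => y j) q) ∧
    ∀ᵐ z ∂((surf d).restrict D.bdryD), μ z = 0

/-- `V(h) = V_h + H²(ℰ)`. -/
def MemVExt {d : ℕ} {D : Domain d} (T : Mesh D) (pt ps : ℕ) (u : SpaceTime d → ℝ) : Prop :=
  ∃ v w, MemVh T pt ps v ∧ MemH2 D.E w ∧ u = v + w

/-- `ξ = γ(w)` is the restriction to `Γ` of the function `w`, that is, on each `∂𝒦` it is the trace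
of `w` from inside `𝒦`. -/
def IsSkeletonTrace {d : ℕ} {D : Domain d} (T : Mesh D) (w ξ : SpaceTime d → ℝ) : Prop :=
  ∀ k, IsTrace (T.K k).carrier w ξ

/-- `H^{3/2}(Γ)`, the space of the traces on `Γ` of functions in `H²(ℰ)`. -/
def MemH32 {d : ℕ} {D : Domain d} (T : Mesh D) (ξ : SpaceTime d → ℝ) : Prop :=
  ∃ w, MemH2 D.E w ∧ IsSkeletonTrace T w ξ

/-- `M(h) = M_h + H^{3/2}(Γ)`. -/
def MemMExt {d : ℕ} {D : Domain d} (T : Mesh D) (pt ps : ℕ) (lam : SpaceTime d → ℝ) : Prop :=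
  ∃ μ ξ, MemMh T pt ps μ ∧ MemH32 T ξ ∧ lam = μ + ξ

/-! ### The advective field -/

/-- `β = (1, β̄)`. -/
noncomputable def stField {d : ℕ} (βbar : SpaceTime d → EuclideanSpace ℝ (Fin d)) :
    SpaceTime d → SpaceTime d :=
  fun z => mkST 1 (βbar z)

/-- `β̄ ∈ L^∞(ℰ)` and `∇·β ∈ L^∞(ℰ)` for `β = (1, β̄)`. -/
def AdmissibleField {d : ℕ} (D : Domain d) (βbar : SpaceTime d → EuclideanSpace ℝ (Fin d)) :
    Prop :=
  MemLp βbar ⊤ (volume.restrict D.E) ∧ ∃ q, IsWeakDiv D.E (stField βbar) q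

/-! ### Bilinear forms and norms -/

namespace Mesh

variable {d : ℕ} {D : Domain d}

/-- `∇_h u` on the element `k`. -/
noncomputable def grad (T : Mesh D) (k : Fin T.numElem) (u : SpaceTime d → ℝ) :
    SpaceTime d → SpaceTime d :=
  weakGrad (T.K k).carrier u

/-- Trace of `u` on the boundary of the element `k`, taken from inside the element. -/
noncomputable def tr (T : Mesh D) (k : Fin T.numElem) (u : SpaceTime d → ℝ) : SpaceTime d → ℝ :=
  trace (T.K k).carrier u

/-- `∇̄_h u · n̄` on the boundary of the element `k`. -/
noncomputable def normalDeriv (T : Mesh D) (k : Fin T.numElem) (u : SpaceTime d → ℝ)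
    (z : SpaceTime d) : ℝ :=
  inner ℝ (spatial (trace (T.K k).carrier (T.grad k u) z))
    (spatial (outerNormal (T.K k).carrier z))

/-- `β · n` on the boundary of the element `k`. -/
noncomputable def bn (T : Mesh D) (βbar : SpaceTime d → EuclideanSpace ℝ (Fin d))
    (k : Fin T.numElem) : SpaceTime d → ℝ :=
  normalTrace (T.K k).carrier (stField βbar)

/-- The advective form `a_h^a((u, λ), (v, μ))`. The integral over `∂ℰ_N` is split over the elements
that touch it; there `n` is the outward normal of the element. -/
noncomputable def formA (T : Mesh D) (βbar : SpaceTime d → EuclideanSpace ℝ (Fin d))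
    (u lam v μ : SpaceTime d → ℝ) : ℝ :=
  -(∑ k, ∫ z in (T.K k).carrier, u z * inner ℝ (stField βbar z) (T.grad k v z))
  + (∑ k, ∫ z in frontier (T.K k).carrier ∩ D.bdryN,
      1 / 2 * (T.bn βbar k z + |T.bn βbar k z|) * lam z * μ z ∂(surf d))
  + ∑ k, ∫ z in frontier (T.K k).carrier,
      1 / 2 * (T.bn βbar k z * (T.tr k u z + lam z) + |T.bn βbar k z| * (T.tr k u z - lam z))
        * (T.tr k v z - μ z) ∂(surf d)

/-- The diffusive form `a_h^d((u, λ), (v, μ))` with penalty parameter `α`. -/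
noncomputable def formD (T : Mesh D) (ν α : ℝ) (u lam v μ : SpaceTime d → ℝ) : ℝ :=
  (∑ k, ∫ z in (T.K k).carrier, ν * inner ℝ (spatial (T.grad k u z)) (spatial (T.grad k v z)))
  + (∑ k, ∫ z in (T.K k).Q,
      ν * α / (T.K k).hK * (T.tr k u z - lam z) * (T.tr k v z - μ z) ∂(surf d))
  - ∑ k, ∫ z in (T.K k).Q,
      (ν * (T.tr k u z - lam z) * T.normalDeriv k v z
        + ν * T.normalDeriv k u z * (T.tr k v z - μ z)) ∂(surf d)

/-- The form `a_h = a_h^a + a_h^d`. -/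
noncomputable def form (T : Mesh D) (βbar : SpaceTime d → EuclideanSpace ℝ (Fin d)) (ν α : ℝ)
    (u lam v μ : SpaceTime d → ℝ) : ℝ :=
  T.formA βbar u lam v μ + T.formD ν α u lam v μ

/-- Square of the stability norm `|||(v, μ)|||_v`. -/
noncomputable def normVSq (T : Mesh D) (βbar : SpaceTime d → EuclideanSpace ℝ (Fin d)) (ν : ℝ)
    (v μ : SpaceTime d → ℝ) : ℝ :=
  (∫ z in D.E, v z ^ 2)
  + (∑ k, ∫ z in frontier (T.K k).carrier ∩ D.bdryN, |T.bn βbar k z| * μ z ^ 2 ∂(surf d))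
  + (∑ k, ∫ z in frontier (T.K k).carrier,
      |T.bn βbar k z| * (T.tr k v z - μ z) ^ 2 ∂(surf d))
  + (∑ k, ν * ∫ z in (T.K k).carrier, ‖spatial (T.grad k v z)‖ ^ 2)
  + ∑ k, ν / (T.K k).hK * ∫ z in (T.K k).Q, (T.tr k v z - μ z) ^ 2 ∂(surf d)

/-- Square of the norm `|||(v, μ)|||_s`. -/
noncomputable def normSSq (T : Mesh D) (βbar : SpaceTime d → EuclideanSpace ℝ (Fin d)) (ν : ℝ)
    (v μ : SpaceTime d → ℝ) : ℝ :=
  T.normVSq βbar ν v μ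
  + ∑ k, T.Δt * (T.K k).hK ^ 2 / (T.Δt + (T.K k).hK)
      * ∫ z in (T.K k).carrier, (T.grad k v z 0) ^ 2

/-- Square of the norm `|||(v, μ)|||_{s,⋆}`. -/
noncomputable def normSStarSq (T : Mesh D) (βbar : SpaceTime d → EuclideanSpace ℝ (Fin d)) (ν : ℝ)
    (v μ : SpaceTime d → ℝ) : ℝ :=
  T.normSSq βbar ν v μ
  + (∑ k, ∫ z in frontier (T.K k).carrier ∩ {z | 0 < T.bn βbar k z},
      |T.bn βbar k z| * T.tr k v z ^ 2 ∂(surf d))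
  + (∑ k, ∫ z in frontier (T.K k).carrier ∩ {z | T.bn βbar k z ≤ 0},
      |T.bn βbar k z| * μ z ^ 2 ∂(surf d))
  + (∑ k, (T.K k).hK * ν * ∫ z in (T.K k).Q, T.normalDeriv k v z ^ 2 ∂(surf d))
  + ∑ k, (T.Δt + (T.K k).hK) / (T.Δt * (T.K k).hK ^ 2) * ∫ z in (T.K k).carrier, v z ^ 2

/-- `|||(v, μ)|||_s`. -/
noncomputable def normS (T : Mesh D) (βbar : SpaceTime d → EuclideanSpace ℝ (Fin d)) (ν : ℝ)
    (v μ : SpaceTime d → ℝ) : ℝ :=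
  Real.sqrt (T.normSSq βbar ν v μ)

/-- `|||(v, μ)|||_{s,⋆}`. -/
noncomputable def normSStar (T : Mesh D) (βbar : SpaceTime d → EuclideanSpace ℝ (Fin d)) (ν : ℝ)
    (v μ : SpaceTime d → ℝ) : ℝ :=
  Real.sqrt (T.normSStarSq βbar ν v μ)

end Mesh

end STHDG

namespace STHDG

/-! The form is a sum over elements of six kinds of integrals: advection, Neumann boundary, upwind
flux, diffusion, penalty, and the two consistency terms taken together. Each local integral is at
most a constant times `√locStar · √locS`, the element contributions to the two squared norms;
Cauchy-Schwarz over the elements (`abs_sum_le_of_local`) then gives the global bound, and `cB` is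
the sum of the six constants.

Most terms need only Cauchy-Schwarz with the weight that the norms already carry. In the advection
term the time part is balanced by `Δt h_K²/(Δt+h_K)` and its inverse, the spatial part by `ν`, `ν⁻¹`
and the bound on `β̄`. The upwind flux is `|β·n|` times the value of `u` on the outflow part and of
`λ` on the inflow part, exactly the boundary quantities that the starred norm adds. In one
consistency term the normal derivative falls on `u`, where the starred norm supplies it.

The other consistency term has the normal derivative of the discrete `v`, which the norm lacks; it
needs the discrete trace inequality `h_K ‖∇̄v·n̄‖²_𝒬 ≤ C ‖∇̄v‖²_𝒦` (`exists_trace_inequality`). This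
is a maximum bound for `∇̄v` times the area of `𝒬`. The maximum bound
(`exists_norm_spatial_weakGrad_le`) comes from equivalence of norms on polynomials over the master
element. Since the element map keeps time, row `0` of its Jacobian is `(1, 0, …, 0)`, so spatial
derivatives on the master element and spatial gradients on the element control each other with no
time derivative mixed in; hence no ratio of `Δt` to `h_K` appears. The area of `𝒬` is at most a
constant times the sum of `∏ edge / h_i` (`JacBd.surf_Q_le`), and shape regularity makes `h_K` times
this comparable to the brick volume (`JacBd.hK_mul_surf_Q_le`), which cancels the volume in the
maximum bound. -/

/-! ### Entries of a matrix and of its inverse, from bounds on the determinant and the first minors.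
-/

theorem abs_adjugate_le {d : ℕ} {A : Matrix (Fin (d + 1)) (Fin (d + 1)) ℝ} {C : ℝ}
    (h : ∀ m n : Fin (d + 1), |(A.submatrix m.succAbove n.succAbove).det| ≤ C)
    (m n : Fin (d + 1)) : |A.adjugate m n| ≤ C := by
  rw [Matrix.adjugate_fin_succ_eq_det_submatrix, abs_mul, abs_pow, abs_neg, abs_one, one_pow,
    one_mul]
  exact h _ _

theorem abs_inv_apply_le {d : ℕ} {A : Matrix (Fin (d + 1)) (Fin (d + 1)) ℝ} {C₁ C₂ : ℝ}
    (hC₁ : 0 < C₁) (hdet : C₁⁻¹ ≤ |A.det|)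
    (h : ∀ m n : Fin (d + 1), |(A.submatrix m.succAbove n.succAbove).det| ≤ C₂)
    (m n : Fin (d + 1)) : |A⁻¹ m n| ≤ C₁ * C₂ := by
  have h1 := abs_adjugate_le h m n
  rw [Matrix.inv_def, Matrix.smul_apply, smul_eq_mul, abs_mul, Ring.inverse_eq_inv', abs_inv]
  have h2 : |A.det|⁻¹ ≤ C₁ := by
    have := inv_anti₀ (by positivity) hdet
    rwa [inv_inv] at this
  exact mul_le_mul h2 h1 (abs_nonneg _) hC₁.le

/-- Minors bound the adjugate; applying this twice bounds `adj (adj A)`, which equals `(det A)^(d-1)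
• A`. Dividing by the determinant, which is bounded below, recovers the entries of `A`. -/
theorem abs_apply_le_of_minors {d : ℕ} (hd : 1 ≤ d)
    {A : Matrix (Fin (d + 1)) (Fin (d + 1)) ℝ} {C₁ C₂ : ℝ}
    (hC₁ : 0 < C₁) (hdet : C₁⁻¹ ≤ |A.det|)
    (h : ∀ m n : Fin (d + 1), |(A.submatrix m.succAbove n.succAbove).det| ≤ C₂)
    (m n : Fin (d + 1)) : |A m n| ≤ C₁ ^ (d - 1) * (d.factorial * C₂ ^ d) := by
  have h0 : 0 < |A.det| := lt_of_lt_of_le (by positivity) hdet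
  have h2 : |A.det|⁻¹ ≤ C₁ := by
    have := inv_anti₀ (by positivity) hdet
    rwa [inv_inv] at this
  have key := A.adjugate_adjugate (by simp; omega)
  have h3 : |A.adjugate.adjugate m n| ≤ d.factorial * C₂ ^ d := by
    refine abs_adjugate_le (fun m n => ?_) m n
    have := Matrix.det_le (A := A.adjugate.submatrix m.succAbove n.succAbove)
      (abv := AbsoluteValue.abs) (x := C₂) (fun i j => abs_adjugate_le h _ _)
    simpa using this
  have hA : A m n = (A.det ^ (d - 1))⁻¹ * A.adjugate.adjugate m n := by
    rw [key, Matrix.smul_apply, smul_eq_mul, Fintype.card_fin, show d + 1 - 2 = d - 1 by omega,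
      inv_mul_cancel_left₀ (pow_ne_zero _ (abs_pos.1 h0))]
  rw [hA, abs_mul, abs_inv, abs_pow, ← inv_pow]
  exact mul_le_mul (pow_le_pow_left₀ (by positivity) h2 _) h3 (abs_nonneg _) (by positivity)

/-! ### The spatial projection, and integrability of the chosen gradients, traces and normals. -/

theorem norm_spatial_le {d : ℕ} (z : SpaceTime d) : ‖spatial z‖ ≤ ‖z‖ := by
  rw [EuclideanSpace.norm_eq, EuclideanSpace.norm_eq]
  apply Real.sqrt_le_sqrt
  rw [Fin.sum_univ_succ]
  simp only [spatial]
  have : 0 ≤ ‖z 0‖ ^ 2 := by positivity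
  linarith

theorem inner_mkST {d : ℕ} (t : ℝ) (x : EuclideanSpace ℝ (Fin d)) (z : SpaceTime d) :
    inner ℝ (mkST t x) z = t * z 0 + inner ℝ x (spatial z) := by
  simp only [PiLp.inner_apply, Fin.sum_univ_succ, mkST, spatial]
  simp [mul_comm]

/-- The projection onto the spatial coordinates as a continuous linear map. -/
noncomputable def spatialL (d : ℕ) : SpaceTime d →L[ℝ] EuclideanSpace ℝ (Fin d) :=
  LinearMap.toContinuousLinearMap
    { toFun := spatial
      map_add' := fun x y => by ext i; simp [spatial]
      map_smul' := fun c x => by ext i; simp [spatial] }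

theorem spatial_sub {d : ℕ} (y z : SpaceTime d) : spatial (y - z) = spatial y - spatial z :=
  map_sub (spatialL d) y z

/-- The default value `0` is itself square integrable, so later estimates never have to prove that a
trace exists. Weak gradients, normals and normal traces are treated alike. -/
theorem trace_spec {d : ℕ} {F : Type*} [NormedAddCommGroup F] [NormedSpace ℝ F]
    (U : Set (SpaceTime d)) (w : SpaceTime d → F) :
    IsTrace U w (trace U w) ∨ trace U w = 0 := by
  unfold trace
  split_ifs with h
  · exact Or.inl h.choose_spec
  · exact Or.inr rfl

theorem trace_memLp {d : ℕ} {F : Type*} [NormedAddCommGroup F] [NormedSpace ℝ F]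
    (U : Set (SpaceTime d)) (w : SpaceTime d → F) :
    MemLp (trace U w) 2 ((surf d).restrict (frontier U)) := by
  rcases trace_spec U w with h | h
  · exact h.2.1
  · rw [h]; exact MemLp.zero

theorem weakGrad_spec {d : ℕ} (U : Set (SpaceTime d)) (u : SpaceTime d → ℝ) :
    IsWeakGrad U u (weakGrad U u) ∨ weakGrad U u = 0 := by
  unfold weakGrad
  split_ifs with h
  · exact Or.inl h.choose_spec
  · exact Or.inr rfl

theorem weakGrad_memLp {d : ℕ} (U : Set (SpaceTime d)) (u : SpaceTime d → ℝ) :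
    MemLp (weakGrad U u) 2 (volume.restrict U) := by
  rcases weakGrad_spec U u with h | h
  · exact h.2.1
  · rw [h]; exact MemLp.zero

theorem outerNormal_aestronglyMeasurable {d : ℕ} (U : Set (SpaceTime d)) :
    AEStronglyMeasurable (outerNormal U) ((surf d).restrict (frontier U)) := by
  unfold outerNormal
  split_ifs with h
  · exact h.choose_spec.1
  · exact aestronglyMeasurable_zero

theorem outerNormal_norm_le {d : ℕ} (U : Set (SpaceTime d)) :
    ∀ᵐ z ∂((surf d).restrict (frontier U)), ‖outerNormal U z‖ ≤ 1 := by
  unfold outerNormal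
  split_ifs with h
  · filter_upwards [h.choose_spec.2.1] with z hz using hz.le
  · simp

theorem normalTrace_memLp {d : ℕ} (U : Set (SpaceTime d)) (β : SpaceTime d → SpaceTime d) :
    MemLp (normalTrace U β) ⊤ ((surf d).restrict (frontier U)) := by
  unfold normalTrace
  split_ifs with h
  · exact h.choose_spec.1
  · exact MemLp.zero

/-- A bound on the spatial part of a field in an open set is inherited by its trace. -/
theorem norm_spatial_trace_le {d : ℕ} {U : Set (SpaceTime d)} (hU : IsOpen U)
    {w : SpaceTime d → SpaceTime d} {S : ℝ} (hS : 0 ≤ S)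
    (hw : ∀ᵐ y ∂(volume.restrict U), ‖spatial (w y)‖ ≤ S) :
    ∀ᵐ z ∂((surf d).restrict (frontier U)), ‖spatial (trace U w z)‖ ≤ S := by
  rcases trace_spec U w with h | h
  · obtain ⟨hwL, -, hlim⟩ := h
    have hmem : ∀ᵐ z ∂((surf d).restrict (frontier U)), z ∈ frontier U :=
      ae_restrict_mem isClosed_frontier.measurableSet
    filter_upwards [hlim, hmem] with z hz hzm
    set g := trace U w z
    -- The pointwise inequality `‖spatial g‖ ≤ S + ‖w y - g‖` is averaged over `U ∩ B(z, r)`, which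
    -- is open and nonempty because `z` is a boundary point. The average tends to `0` with `r`.
    have hle : ∀ᶠ r : ℝ in 𝓝[>] 0,
        ‖spatial g‖ ≤ S + ⨍ y in U ∩ Metric.ball z r, ‖w y - g‖ := by
      filter_upwards [self_mem_nhdsWithin] with r hr
      set V := U ∩ Metric.ball z r
      have hVo : IsOpen V := hU.inter Metric.isOpen_ball
      have hne : V.Nonempty := by
        have := mem_closure_iff.1 (frontier_subset_closure hzm) _ Metric.isOpen_ball
          (Metric.mem_ball_self hr)
        rwa [inter_comm] at this
      have hpos : 0 < volume V := hVo.measure_pos _ hne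
      have hfin : volume V < ⊤ :=
        (measure_mono inter_subset_right).trans_lt measure_ball_lt_top
      have : IsFiniteMeasure (volume.restrict V) := ⟨by simpa using hfin⟩
      have : NeZero (volume.restrict V) := ⟨by
        rw [Ne, Measure.restrict_eq_zero]; exact hpos.ne'⟩
      have hwV : MemLp w 2 (volume.restrict V) := hwL.mono_measure
        (Measure.restrict_mono inter_subset_left le_rfl)
      have hint : Integrable (fun y => ‖w y - g‖) (volume.restrict V) :=
        ((hwV.integrable (by norm_num)).sub (integrable_const g)).norm
      have hwV' : ∀ᵐ y ∂(volume.restrict V), ‖spatial (w y)‖ ≤ S :=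
        ae_mono (Measure.restrict_mono inter_subset_left le_rfl) hw
      have h1 : ∫ y in V, ‖spatial g‖ ≤ ∫ y in V, (S + ‖w y - g‖) := by
        refine integral_mono_ae (integrable_const _) ((integrable_const _).add hint) ?_
        filter_upwards [hwV'] with y hy
        have h2 : spatial g = spatial (w y) - spatial (w y - g) := by
          rw [spatial_sub]; abel
        calc ‖spatial g‖ ≤ ‖spatial (w y)‖ + ‖spatial (w y - g)‖ := by
              rw [h2]; exact norm_sub_le _ _
          _ ≤ S + ‖w y - g‖ := add_le_add hy (norm_spatial_le _)
      rw [integral_add (integrable_const _) hint] at h1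
      simp only [integral_const, smul_eq_mul, measureReal_restrict_apply_univ] at h1
      have hr0 : 0 < volume.real V := ENNReal.toReal_pos hpos.ne' hfin.ne
      rw [setAverage_eq, smul_eq_mul]
      have h3 : volume.real V * ‖spatial g‖ ≤
          volume.real V * (S + (volume.real V)⁻¹ * ∫ y in V, ‖w y - g‖) := by
        rw [mul_add, mul_inv_cancel_left₀ hr0.ne']
        exact h1
      exact le_of_mul_le_mul_left h3 hr0
    have := ge_of_tendsto (hz.const_add S) hle
    simpa using this
  · rw [h]
    filter_upwards with z
    have : spatial (0 : SpaceTime d) = 0 := map_zero (spatialL d)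
    simpa [this] using hS

/-! ### Polynomials on the master element and equivalence of their norms. -/

theorem isOpen_refCube (d : ℕ) : IsOpen (refCube d) := by
  have : refCube d = ⋂ j, (fun y : SpaceTime d => y j) ⁻¹' Ioo (-1) 1 := by
    ext; simp [refCube]
  rw [this]
  exact isOpen_iInter_of_finite fun j => isOpen_Ioo.preimage (by fun_prop)

theorem isCompact_refCubeClosed (d : ℕ) : IsCompact (refCubeClosed d) := by
  have : refCubeClosed d = (fun y : SpaceTime d => (y : Fin (d + 1) → ℝ)) ⁻¹'
      Set.pi univ (fun _ => Icc (-1) 1) := by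
    ext y
    simp only [refCubeClosed, mem_ofPred_eq, mem_preimage, Set.mem_pi, mem_univ, true_implies]
  rw [this]
  exact (PiLp.homeomorph 2 (fun _ : Fin (d + 1) => ℝ)).isCompact_preimage.2
    (isCompact_univ_pi fun _ => isCompact_Icc)

theorem refCube_subset (d : ℕ) : refCube d ⊆ refCubeClosed d :=
  fun _ hy j => Ioo_subset_Icc_self (hy j)

theorem volume_refCube_lt_top (d : ℕ) : volume (refCube d) < ⊤ :=
  (measure_mono (refCube_subset d)).trans_lt (isCompact_refCubeClosed d).measure_lt_top

theorem continuous_eval_coord {d : ℕ} (q : MvPolynomial (Fin (d + 1)) ℝ) :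
    Continuous (fun y : SpaceTime d => MvPolynomial.eval (fun j => y j) q) :=
  (MvPolynomial.continuous_eval q).comp (by fun_prop)

theorem memLp_eval_refCube {d : ℕ} (q : MvPolynomial (Fin (d + 1)) ℝ) :
    MemLp (fun y : SpaceTime d => MvPolynomial.eval (fun j => y j) q) 2
      (volume.restrict (refCube d)) := by
  obtain ⟨C, hC⟩ := (isCompact_refCubeClosed d).exists_bound_of_continuousOn
    (continuous_eval_coord q).continuousOn
  have : IsFiniteMeasure (volume.restrict (refCube d)) :=
    ⟨by simpa using volume_refCube_lt_top d⟩
  refine MemLp.of_bound (continuous_eval_coord q).aestronglyMeasurable C ?_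
  filter_upwards [ae_restrict_mem (isOpen_refCube d).measurableSet] with y hy
  exact hC y (refCube_subset d hy)

/-- The class in `L²` of the master element of a polynomial. -/
noncomputable def polyToLp (d : ℕ) :
    MvPolynomial (Fin (d + 1)) ℝ →ₗ[ℝ] Lp ℝ 2 (volume.restrict (refCube d)) where
  toFun q := (memLp_eval_refCube q).toLp _
  map_add' p q := by
    rw [← MemLp.toLp_add]
    congr 1
    ext y; simp
  map_smul' c q := by
    rw [RingHom.id_apply, ← MemLp.toLp_const_smul]
    congr 1
    ext y; simp

/-- Continuous functions that agree almost everywhere on an open set agree there, and a polynomial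
is determined by its values on a product of infinite sets. -/
theorem polyToLp_injective (d : ℕ) : Function.Injective (polyToLp d) := by
  intro p q h
  have h1 := (MemLp.toLp_eq_toLp_iff (memLp_eval_refCube p) (memLp_eval_refCube q)).1 h
  have h2 := Measure.eqOn_open_of_ae_eq h1 (isOpen_refCube d)
    (continuous_eval_coord p).continuousOn (continuous_eval_coord q).continuousOn
  refine MvPolynomial.funext_set (s := fun _ => Ioo (-1 : ℝ) 1)
    (fun _ => Ioo_infinite (by norm_num)) fun x hx => ?_
  exact h2 (x := WithLp.toLp 2 x) (fun j => hx j (mem_univ _))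

theorem sq_norm_polyToLp {d : ℕ} (q : MvPolynomial (Fin (d + 1)) ℝ) :
    ‖polyToLp d q‖ ^ 2 = ∫ y in refCube d, (MvPolynomial.eval (fun j => y j) q) ^ 2 := by
  rw [← real_inner_self_eq_norm_sq, L2.inner_def]
  refine integral_congr_ae ?_
  filter_upwards [(memLp_eval_refCube q).coeFn_toLp] with y hy
  change inner ℝ ((memLp_eval_refCube q).toLp _ y) ((memLp_eval_refCube q).toLp _ y) = _
  rw [hy]
  simp [sq]

/-- Polynomials of bounded degree: the maximum norm is controlled by the `L²` norm. -/
theorem exists_sq_eval_le (d n : ℕ) : ∃ C : ℝ, 0 ≤ C ∧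
    ∀ q ∈ MvPolynomial.restrictDegree (Fin (d + 1)) ℝ n, ∀ y ∈ refCube d,
      (MvPolynomial.eval (fun j => y j) q) ^ 2
        ≤ C * ∫ y in refCube d, (MvPolynomial.eval (fun j => y j) q) ^ 2 := by
  let W := MvPolynomial.restrictDegree (Fin (d + 1)) ℝ n
  let L : W →ₗ[ℝ] Lp ℝ 2 (volume.restrict (refCube d)) := (polyToLp d).comp W.subtype
  have hLinj : Function.Injective L := (polyToLp_injective d).comp W.injective_subtype
  let R := LinearMap.range L
  let e : W ≃ₗ[ℝ] R := LinearEquiv.ofInjective L hLinj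
  have : FiniteDimensional ℝ W := inferInstanceAs (Module.Finite ℝ
    (MvPolynomial.restrictDegree (Fin (d + 1)) ℝ n))
  have : FiniteDimensional ℝ R := e.finiteDimensional
  have : CompactSpace (refCubeClosed d) :=
    isCompact_iff_compactSpace.1 (isCompact_refCubeClosed d)
  let ev : W →ₗ[ℝ] C(refCubeClosed d, ℝ) :=
    { toFun := fun q => ⟨fun y => MvPolynomial.eval (fun j => y.1 j) q.1,
        (continuous_eval_coord q.1).comp continuous_subtype_val⟩
      map_add' := fun p q => by ext y; simp
      map_smul' := fun c q => by ext y; simp }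
  -- `G` sends the `L²` class of a polynomial to its values on the closed cube. Its domain is
  -- finite-dimensional, so it is bounded, and `‖G‖²` is the constant sought.
  let G : R →L[ℝ] C(refCubeClosed d, ℝ) := LinearMap.toContinuousLinearMap (ev ∘ₗ e.symm.toLinearMap)
  refine ⟨‖G‖ ^ 2, by positivity, fun q hq y hy => ?_⟩
  have h1 := G.le_opNorm (e ⟨q, hq⟩)
  have h2 : G (e ⟨q, hq⟩) = ev ⟨q, hq⟩ := by
    change ev (e.symm (e ⟨q, hq⟩)) = _
    rw [e.symm_apply_apply]
  rw [h2] at h1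
  have h3 := (ev ⟨q, hq⟩).norm_coe_le_norm ⟨y, refCube_subset d hy⟩
  have h4 : ‖e ⟨q, hq⟩‖ = ‖polyToLp d q‖ := rfl
  rw [h4] at h1
  have h5 : |MvPolynomial.eval (fun j => y j) q| ≤ ‖G‖ * ‖polyToLp d q‖ := h3.trans h1
  rw [← sq_norm_polyToLp, ← mul_pow, ← sq_abs]
  exact pow_le_pow_left₀ (abs_nonneg _) h5 2

/-- Places all derivatives in one finite-dimensional space, so that a single norm-equivalence
constant serves for every spatial direction. -/
theorem IsTensorPoly.pderiv_mem {d pt ps : ℕ} {q : MvPolynomial (Fin (d + 1)) ℝ}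
    (hq : IsTensorPoly pt ps q) (i : Fin (d + 1)) :
    MvPolynomial.pderiv i q ∈ MvPolynomial.restrictDegree (Fin (d + 1)) ℝ (max pt ps) := by
  have h1 : ∀ j, q.degreeOf j ≤ max pt ps := by
    intro j
    refine Fin.cases ?_ (fun j => ?_) j
    · exact hq.1.trans (le_max_left _ _)
    · exact (hq.2 j).trans (le_max_right _ _)
  rw [MvPolynomial.mem_restrictDegree]
  intro s hs j
  rw [MvPolynomial.mem_support_iff, MvPolynomial.coeff_pderiv] at hs
  have h2 : s + Finsupp.single i 1 ∈ q.support := by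
    rw [MvPolynomial.mem_support_iff]
    intro h; simp [h] at hs
  have h3 := MvPolynomial.degreeOf_le_iff.1 (h1 j) _ h2
  simp only [Finsupp.add_apply] at h3
  omega

/-! ### Weak gradients of functions that are `C¹` on an open set. -/

theorem integrable_mul_of_continuousOn {d : ℕ} {U : Set (SpaceTime d)} (hU : IsOpen U)
    {F χ : SpaceTime d → ℝ} (hF : ContinuousOn F U) (hχ : Continuous χ)
    (hc : HasCompactSupport χ) (hs : tsupport χ ⊆ U) : Integrable (fun z => F z * χ z) := by
  have h1 : tsupport (fun z => F z * χ z) ⊆ tsupport χ :=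
    closure_mono (Function.support_mul_subset_right F χ)
  have h2 : Continuous (fun z => F z * χ z) :=
    (hF.mul hχ.continuousOn).continuous_of_tsupport_subset hU (h1.trans hs)
  have h3 : HasCompactSupport (fun z => F z * χ z) := HasCompactSupport.mul_left (f := F) hc
  exact h2.integrable_of_hasCompactSupport h3

theorem setIntegral_eq_of_tsupport {d : ℕ} {U : Set (SpaceTime d)}
    {F χ : SpaceTime d → ℝ} (hs : tsupport χ ⊆ U) :
    ∫ z in U, F z * χ z = ∫ z, F z * χ z := by
  refine setIntegral_eq_integral_of_forall_compl_eq_zero fun z hz => ?_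
  rw [image_eq_zero_of_notMem_tsupport fun h => hz (hs h), mul_zero]

theorem integral_mul_fderiv_of_contDiffOn {d : ℕ} {U : Set (SpaceTime d)} (hU : IsOpen U)
    {V χ : SpaceTime d → ℝ} (hV : ContDiffOn ℝ 1 V U) (hχ : ContDiff ℝ ∞ χ)
    (hc : HasCompactSupport χ) (hs : tsupport χ ⊆ U) (v : SpaceTime d) :
    ∫ z, V z * fderiv ℝ χ z v = -∫ z, fderiv ℝ V z v * χ z := by
  have hVc : ContinuousOn (fun z => fderiv ℝ V z v) U :=
    (hV.continuousOn_fderiv_of_isOpen hU le_rfl).clm_apply continuousOn_const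
  have hχ' : Continuous (fun z => fderiv ℝ χ z v) :=
    (hχ.continuous_fderiv (by simp)).clm_apply continuous_const
  refine integral_bilinear_hasFDerivAt_right_eq_neg_left_of_integrable
    (B := ContinuousLinearMap.mul ℝ ℝ) (f' := fderiv ℝ V) (g' := fderiv ℝ χ) ?_ ?_ ?_ ?_ ?_
  · exact integrable_mul_of_continuousOn hU hVc hχ.continuous hc hs
  · exact integrable_mul_of_continuousOn hU hV.continuousOn hχ' (hc.fderiv_apply ℝ v)
      ((tsupport_fderiv_apply_subset ℝ v).trans hs)
  · exact integrable_mul_of_continuousOn hU hV.continuousOn hχ.continuous hc hs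
  · intro x hx
    exact ((hV.contDiffAt (hU.mem_nhds (hs hx))).differentiableAt (by simp)).hasFDerivAt
  · intro x _
    exact (hχ.differentiable (by simp) x).hasFDerivAt

/-- The weak gradient of a `C¹` function is its classical gradient. -/
theorem IsWeakGrad.ae_eq_fderiv {d : ℕ} {U : Set (SpaceTime d)} (hU : IsOpen U)
    {u V : SpaceTime d → ℝ} {g : SpaceTime d → SpaceTime d} (h : IsWeakGrad U u g)
    (hV : ContDiffOn ℝ 1 V U) (huV : u =ᵐ[volume.restrict U] V) :
    ∀ᵐ z ∂(volume.restrict U), ∀ j, g z j = fderiv ℝ V z (basisVec j) := by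
  rw [ae_all_iff]
  intro j
  have hVc : ContinuousOn (fun z => fderiv ℝ V z (basisVec j)) U :=
    (hV.continuousOn_fderiv_of_isOpen hU le_rfl).clm_apply continuousOn_const
  have hg : MemLp (fun z => g z j) 2 (volume.restrict U) :=
    h.2.1.continuousLinearMap_comp (EuclideanSpace.proj (𝕜 := ℝ) j)
  have hloc : LocallyIntegrableOn (fun z => g z j - fderiv ℝ V z (basisVec j)) U :=
    (locallyIntegrableOn_of_locallyIntegrable_restrict
      (hg.locallyIntegrable (by norm_num))).sub
      (hVc.locallyIntegrableOn hU.measurableSet)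
  -- Fundamental lemma of the calculus of variations: by integration by parts the difference of the
  -- weak and classical derivatives is orthogonal to every test function.
  have key := hU.ae_eq_zero_of_integral_contDiff_smul_eq_zero hloc ?_
  · rw [ae_restrict_iff' hU.measurableSet]
    filter_upwards [key] with z hz hzU
    exact sub_eq_zero.1 (hz hzU)
  · intro χ hχ hc hs
    have h1 := h.2.2 χ hχ hc hs j
    have h2 : ∫ z in U, u z * fderiv ℝ χ z (basisVec j)
        = ∫ z in U, V z * fderiv ℝ χ z (basisVec j) := by
      refine integral_congr_ae ?_
      filter_upwards [huV] with z hz using by rw [hz]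
    have hi : Integrable (fun z => g z j * χ z) (volume.restrict U) :=
      hg.integrable_mul (q := 2) (hχ.continuous.memLp_of_hasCompactSupport hc)
    rw [h2, setIntegral_eq_of_tsupport ((tsupport_fderiv_apply_subset ℝ (basisVec j)).trans hs),
      integral_mul_fderiv_of_contDiffOn hU hV hχ hc hs, neg_inj,
      ← setIntegral_eq_of_tsupport hs] at h1
    calc ∫ z, χ z • (g z j - fderiv ℝ V z (basisVec j))
        = ∫ z, (g z j - fderiv ℝ V z (basisVec j)) * χ z := by
          simp only [smul_eq_mul, mul_comm]
      _ = ∫ z in U, (g z j - fderiv ℝ V z (basisVec j)) * χ z :=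
          (setIntegral_eq_of_tsupport hs).symm
      _ = ∫ z in U, (g z j * χ z - fderiv ℝ V z (basisVec j) * χ z) := by
          simp only [sub_mul]
      _ = 0 := by
          rw [integral_sub hi
            (integrable_mul_of_continuousOn hU hVc hχ.continuous hc hs).integrableOn, h1, sub_self]

theorem contDiff_eval_coord {d : ℕ} (q : MvPolynomial (Fin (d + 1)) ℝ) :
    ContDiff ℝ 1 (fun y : SpaceTime d => MvPolynomial.eval (fun j => y j) q) := by
  induction q using MvPolynomial.induction_on with
  | C a => simp only [MvPolynomial.eval_C]; exact contDiff_const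
  | add p q hp hq => simp only [map_add]; exact hp.add hq
  | mul_X p n hp =>
    simp only [map_mul, MvPolynomial.eval_X]
    exact hp.mul (by fun_prop)

theorem fderiv_eval_coord {d : ℕ} (q : MvPolynomial (Fin (d + 1)) ℝ) (y : SpaceTime d)
    (i : Fin (d + 1)) :
    fderiv ℝ (fun y : SpaceTime d => MvPolynomial.eval (fun j => y j) q) y (basisVec i)
      = MvPolynomial.eval (fun j => y j) (MvPolynomial.pderiv i q) := by
  have hdiff : ∀ p : MvPolynomial (Fin (d + 1)) ℝ,
      DifferentiableAt ℝ (fun y : SpaceTime d => MvPolynomial.eval (fun j => y j) p) y :=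
    fun p => (contDiff_eval_coord p).differentiable (by simp) y
  induction q using MvPolynomial.induction_on with
  | C a => simp
  | add p q hp hq =>
    simp only [map_add]
    rw [fderiv_fun_add (hdiff p) (hdiff q), add_apply, hp, hq]
  | mul_X p n hp =>
    have hX : HasFDerivAt (fun y : SpaceTime d => y n) (EuclideanSpace.proj (𝕜 := ℝ) n) y :=
      (EuclideanSpace.proj (𝕜 := ℝ) n).hasFDerivAt
    simp only [map_mul, MvPolynomial.eval_X]
    have h := ((hdiff p).hasFDerivAt.fun_mul hX).fderiv
    rw [h, add_apply, smul_apply, smul_apply, hp]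
    by_cases hin : n = i
    · subst hin
      simp [basisVec]
    · simp [basisVec, MvPolynomial.pderiv_X, hin]

/-! ### The map from the master element: derivative, determinant, `C¹` inverse. -/

namespace Element

variable {d : ℕ} {Δt : ℝ}

/-- The edge lengths of the space-time brick. -/
def edge (K : Element d Δt) : Fin (d + 1) → ℝ := Fin.cons Δt K.h

theorem edge_pos (K : Element d Δt) (hΔt : 0 < Δt) (j : Fin (d + 1)) : 0 < K.edge j := by
  refine Fin.cases ?_ (fun i => ?_) j
  · simpa [edge] using hΔt
  · simpa [edge] using K.h_pos i

/-- The linear part of the affine map from the master element to the brick. -/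
noncomputable def diagL (K : Element d Δt) : SpaceTime d →L[ℝ] SpaceTime d :=
  LinearMap.toContinuousLinearMap
    { toFun := fun y => WithLp.toLp 2 fun j => K.edge j / 2 * y j
      map_add' := fun x y => by ext j; simp [mul_add]
      map_smul' := fun c x => by ext j; simp; ring }

theorem diagL_apply (K : Element d Δt) (y : SpaceTime d) (j : Fin (d + 1)) :
    K.diagL y j = K.edge j / 2 * y j := rfl

theorem affineMap_eq (K : Element d Δt) (y : SpaceTime d) :
    affineMap Δt K.h K.b y = K.diagL y + K.b := by
  ext j
  rw [PiLp.add_apply, diagL_apply]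
  simp only [affineMap]
  congr 2
  refine Fin.cases ?_ (fun i => ?_) j <;> simp [edge]

theorem affineMap_apply (K : Element d Δt) (y : SpaceTime d) (j : Fin (d + 1)) :
    affineMap Δt K.h K.b y j = K.edge j / 2 * y j + K.b j := by
  rw [affineMap_eq, PiLp.add_apply, diagL_apply]

theorem hasFDerivAt_affineMap (K : Element d Δt) (y : SpaceTime d) :
    HasFDerivAt (affineMap Δt K.h K.b) K.diagL y := by
  have : affineMap Δt K.h K.b = fun y => K.diagL y + K.b := funext K.affineMap_eq
  rw [this]
  exact K.diagL.hasFDerivAt.add_const _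

theorem contDiff_affineMap (K : Element d Δt) : ContDiff ℝ 1 (affineMap Δt K.h K.b) := by
  have : affineMap Δt K.h K.b = fun y => K.diagL y + K.b := funext K.affineMap_eq
  rw [this]
  exact K.diagL.contDiff.add contDiff_const

theorem diagL_basisVec (K : Element d Δt) (j : Fin (d + 1)) :
    K.diagL (basisVec j) = (K.edge j / 2) • basisVec j := by
  ext i
  rw [diagL_apply, PiLp.smul_apply, smul_eq_mul]
  by_cases h : i = j
  · subst h; rfl
  · simp [basisVec, h]

theorem contDiff_Φ (K : Element d Δt) : ContDiff ℝ 1 K.Φ :=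
  K.contDiff.comp K.contDiff_affineMap

theorem hasFDerivAt_Φ (K : Element d Δt) (y : SpaceTime d) :
    HasFDerivAt K.Φ ((fderiv ℝ K.φ (affineMap Δt K.h K.b y)).comp K.diagL) y :=
  ((K.contDiff.differentiable (by simp)) _).hasFDerivAt.comp y (K.hasFDerivAt_affineMap y)

theorem jac_det (K : Element d Δt) (z : SpaceTime d) :
    (K.jac z).det = (fderiv ℝ K.φ z).det := by
  rw [ContinuousLinearMap.det,
    ← LinearMap.det_toMatrix (EuclideanSpace.basisFun (Fin (d + 1)) ℝ).toBasis]
  congr 1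

theorem diagL_det (K : Element d Δt) : K.diagL.det = ∏ j, K.edge j / 2 := by
  rw [ContinuousLinearMap.det,
    ← LinearMap.det_toMatrix (EuclideanSpace.basisFun (Fin (d + 1)) ℝ).toBasis,
    ← Matrix.det_diagonal]
  congr 1
  ext m n
  rw [LinearMap.toMatrix_apply]
  by_cases h : m = n
  · subst h; simp [diagL_apply]
  · simp [diagL_apply, h]

theorem fderiv_Φ_det (K : Element d Δt) (y : SpaceTime d) :
    ((fderiv ℝ K.φ (affineMap Δt K.h K.b y)).comp K.diagL).det
      = (K.jac (affineMap Δt K.h K.b y)).det * ∏ j, K.edge j / 2 := by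
  rw [jac_det, ← diagL_det]
  exact LinearMap.det_comp _ _

theorem affineMap_injective (K : Element d Δt) (hΔt : 0 < Δt) :
    Function.Injective (affineMap Δt K.h K.b) := by
  intro x y h
  ext j
  have h1 := congrArg (fun z : SpaceTime d => z j) h
  simp only [affineMap_apply] at h1
  have := (K.edge_pos hΔt j).ne'
  have h2 : K.edge j / 2 * x j = K.edge j / 2 * y j := by linarith
  exact mul_left_cancel₀ (by positivity) h2

theorem injOn_Φ (K : Element d Δt) (hΔt : 0 < Δt) : InjOn K.Φ (refCubeClosed d) :=
  fun _ hx _ hy h => K.affineMap_injective hΔt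
    (K.injOn (mem_image_of_mem _ hx) (mem_image_of_mem _ hy) h)

theorem carrier_eq (K : Element d Δt) : K.carrier = K.Φ '' refCube d := by
  rw [carrier, brick, image_image]; rfl

theorem det_Φ_ne_zero (K : Element d Δt) (hΔt : 0 < Δt) {y : SpaceTime d}
    (hy : y ∈ refCubeClosed d) :
    ((fderiv ℝ K.φ (affineMap Δt K.h K.b y)).comp K.diagL).det ≠ 0 := by
  rw [fderiv_Φ_det, jac_det]
  refine mul_ne_zero (K.det_ne_zero _ (mem_image_of_mem _ hy)) (Finset.prod_ne_zero_iff.2 ?_)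
  intro j _
  have := (K.edge_pos hΔt j).ne'
  positivity

/-- The derivative of `Φ` as a linear equivalence. -/
noncomputable def derivEquiv (K : Element d Δt) (hΔt : 0 < Δt) {y : SpaceTime d}
    (hy : y ∈ refCubeClosed d) : SpaceTime d ≃L[ℝ] SpaceTime d :=
  ContinuousLinearMap.toContinuousLinearEquivOfDetNeZero _ (K.det_Φ_ne_zero hΔt hy)

theorem hasFDerivAt_Φ_equiv (K : Element d Δt) (hΔt : 0 < Δt) {y : SpaceTime d}
    (hy : y ∈ refCubeClosed d) :
    HasFDerivAt K.Φ (K.derivEquiv hΔt hy : SpaceTime d →L[ℝ] SpaceTime d) y := by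
  rw [derivEquiv, ContinuousLinearMap.coe_toContinuousLinearEquivOfDetNeZero]
  exact K.hasFDerivAt_Φ y

/-- The inverse function theorem makes `Φ` open; with injectivity this yields the homeomorphism
`homeo` and the openness of the element. -/
theorem map_nhds_Φ (K : Element d Δt) (hΔt : 0 < Δt) {y : SpaceTime d}
    (hy : y ∈ refCubeClosed d) : map K.Φ (𝓝 y) = 𝓝 (K.Φ y) :=
  (K.contDiff_Φ.contDiffAt.hasStrictFDerivAt' (K.hasFDerivAt_Φ_equiv hΔt hy)
    (by simp)).map_nhds_eq_of_equiv

/-- `Φ` as a homeomorphism between the master element and the element. -/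
noncomputable def homeo (K : Element d Δt) (hΔt : 0 < Δt) :
    OpenPartialHomeomorph (SpaceTime d) (SpaceTime d) :=
  OpenPartialHomeomorph.ofContinuousOpenRestrict
    (((K.injOn_Φ hΔt).mono (refCube_subset d)).toPartialEquiv K.Φ (refCube d))
    K.contDiff_Φ.continuous.continuousOn
    (by
      rw [isOpenMap_iff_nhds_le]
      rintro ⟨y, hy⟩
      change 𝓝 (K.Φ y) ≤ map (K.Φ ∘ Subtype.val) (𝓝 (⟨y, hy⟩ : refCube d))
      rw [← Filter.map_map, map_nhds_subtype_val, (isOpen_refCube d).nhdsWithin_eq hy,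
        K.map_nhds_Φ hΔt (refCube_subset d hy)])
    (isOpen_refCube d)

theorem homeo_target (K : Element d Δt) (hΔt : 0 < Δt) : (K.homeo hΔt).target = K.carrier :=
  K.carrier_eq.symm

theorem isOpen_carrier (K : Element d Δt) (hΔt : 0 < Δt) : IsOpen K.carrier :=
  K.homeo_target hΔt ▸ (K.homeo hΔt).open_target

theorem homeo_symm_mem (K : Element d Δt) (hΔt : 0 < Δt) {z : SpaceTime d} (hz : z ∈ K.carrier) :
    (K.homeo hΔt).symm z ∈ refCube d :=
  (K.homeo hΔt).map_target (by rwa [homeo_target])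

theorem Φ_homeo_symm (K : Element d Δt) (hΔt : 0 < Δt) {z : SpaceTime d} (hz : z ∈ K.carrier) :
    K.Φ ((K.homeo hΔt).symm z) = z :=
  (K.homeo hΔt).right_inv (by rwa [homeo_target])

theorem homeo_symm_Φ (K : Element d Δt) (hΔt : 0 < Δt) {y : SpaceTime d} (hy : y ∈ refCube d) :
    (K.homeo hΔt).symm (K.Φ y) = y :=
  (K.homeo hΔt).left_inv hy

theorem contDiffOn_homeo_symm (K : Element d Δt) (hΔt : 0 < Δt) :
    ContDiffOn ℝ 1 (K.homeo hΔt).symm K.carrier := by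
  intro z hz
  have hy := refCube_subset d (K.homeo_symm_mem hΔt hz)
  exact ((K.homeo hΔt).contDiffAt_symm (f₀' := K.derivEquiv hΔt hy)
    (by rwa [homeo_target]) (K.hasFDerivAt_Φ_equiv hΔt hy)
    K.contDiff_Φ.contDiffAt).contDiffWithinAt

end Element

theorem norm_spatial_sq {d : ℕ} (z : SpaceTime d) : ‖spatial z‖ ^ 2 = ∑ i : Fin d, z i.succ ^ 2 := by
  rw [EuclideanSpace.norm_sq_eq]
  simp [spatial]

theorem sq_sum_mul_le {ι : Type*} [Fintype ι] {a b : ι → ℝ} {M : ℝ} (ha : ∀ i, |a i| ≤ M) :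
    (∑ i, a i * b i) ^ 2 ≤ Fintype.card ι * M ^ 2 * ∑ i, b i ^ 2 := by
  refine (Finset.sum_mul_sq_le_sq_mul_sq _ _ _).trans
    (mul_le_mul_of_nonneg_right ?_ (Finset.sum_nonneg fun i _ => sq_nonneg _))
  calc ∑ i, a i ^ 2 ≤ ∑ _i : ι, M ^ 2 :=
        Finset.sum_le_sum fun i _ => by
          rw [← sq_abs]; exact pow_le_pow_left₀ (abs_nonneg _) (ha i) 2
    _ = Fintype.card ι * M ^ 2 := by simp

/-- The classical gradient. -/
noncomputable def classGrad {d : ℕ} (V : SpaceTime d → ℝ) (z : SpaceTime d) : SpaceTime d :=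
  WithLp.toLp 2 fun j => fderiv ℝ V z (basisVec j)

/-- Shrinking a point of the closed cube towards the origin moves it into the open cube. -/
theorem subset_closure_refCube (d : ℕ) : refCubeClosed d ⊆ closure (refCube d) := by
  intro y hy
  have hlim : Tendsto (fun t : ℝ => t • y) (𝓝[<] 1) (𝓝 y) := by
    have : Tendsto (fun t : ℝ => t • y) (𝓝 1) (𝓝 ((1 : ℝ) • y)) :=
      (continuous_id.smul continuous_const).tendsto 1
    rw [one_smul] at this
    exact this.mono_left nhdsWithin_le_nhds
  refine mem_closure_of_tendsto hlim ?_
  filter_upwards [Ioo_mem_nhdsLT (show (0 : ℝ) < 1 by norm_num)] with t ht j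
  have h1 := hy j
  simp only [PiLp.smul_apply, smul_eq_mul]
  constructor <;> nlinarith [h1.1, h1.2, ht.1, ht.2]

theorem convex_refCube (d : ℕ) : Convex ℝ (refCube d) := by
  intro x hx y hy a b ha hb hab j
  exact convex_Ioo (-1 : ℝ) 1 (hx j) (hy j) ha hb hab

namespace Element

variable {d : ℕ} {Δt : ℝ}

theorem fderiv_φ_basisVec (K : Element d Δt) (z : SpaceTime d) (n : Fin (d + 1)) :
    fderiv ℝ K.φ z (basisVec n) = ∑ m, K.jac z m n • basisVec m := by
  ext k
  simp [jac, basisVec, Pi.single_apply]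

theorem Φ_time (K : Element d Δt) {y : SpaceTime d} (hy : y ∈ refCubeClosed d) :
    K.Φ y 0 = Δt / 2 * y 0 + K.b 0 := by
  rw [Φ, K.time_eq _ (mem_image_of_mem _ hy), affineMap_apply]
  rfl

theorem fderiv_comp_Φ (K : Element d Δt) {V : SpaceTime d → ℝ} {y : SpaceTime d}
    (hV : DifferentiableAt ℝ V (K.Φ y)) (i : Fin (d + 1)) :
    fderiv ℝ (fun y => V (K.Φ y)) y (basisVec i)
      = K.edge i / 2 * ∑ m, K.jac (affineMap Δt K.h K.b y) m i * classGrad V (K.Φ y) m := by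
  have h := (hV.hasFDerivAt.comp y (K.hasFDerivAt_Φ y)).fderiv
  change fderiv ℝ (V ∘ K.Φ) y (basisVec i) = _
  rw [h]
  simp only [ContinuousLinearMap.comp_apply, diagL_basisVec, map_smul, fderiv_φ_basisVec, map_sum,
    smul_eq_mul, classGrad]

/-- The time coordinate of `Φ` is `Δt/2 * y 0 + b 0` near `y`; the chain rule for the coordinate
function `z ↦ z 0` reads off row `0`. This is where preservation of time separates spatial from
temporal derivatives. -/
theorem jac_zero (K : Element d Δt) (hΔt : 0 < Δt) {y : SpaceTime d} (hy : y ∈ refCube d)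
    (n : Fin (d + 1)) :
    K.jac (affineMap Δt K.h K.b y) 0 n = (1 : Matrix (Fin (d + 1)) (Fin (d + 1)) ℝ) 0 n := by
  have hproj : HasFDerivAt (fun z : SpaceTime d => z 0) (EuclideanSpace.proj (𝕜 := ℝ) 0)
      (K.Φ y) := (EuclideanSpace.proj (𝕜 := ℝ) 0).hasFDerivAt
  have h1 := K.fderiv_comp_Φ hproj.differentiableAt n
  have hlin : HasFDerivAt (fun y : SpaceTime d => Δt / 2 * y 0 + K.b 0)
      ((Δt / 2) • (EuclideanSpace.proj (𝕜 := ℝ) 0 : SpaceTime d →L[ℝ] ℝ)) y :=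
    ((EuclideanSpace.proj (𝕜 := ℝ) 0 : SpaceTime d →L[ℝ] ℝ).hasFDerivAt.const_mul _).add_const _
  have heq : (fun y => K.Φ y 0) =ᶠ[𝓝 y] fun y => Δt / 2 * y 0 + K.b 0 := by
    filter_upwards [(isOpen_refCube d).mem_nhds hy] with x hx
    exact K.Φ_time (refCube_subset d hx)
  rw [heq.fderiv_eq, hlin.fderiv] at h1
  simp only [classGrad, hproj.fderiv] at h1
  have hpos := K.edge_pos hΔt n
  have h2 : ∑ m, K.jac (affineMap Δt K.h K.b y) m n * (EuclideanSpace.proj (𝕜 := ℝ) 0 :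
      SpaceTime d →L[ℝ] ℝ) (basisVec m) = K.jac (affineMap Δt K.h K.b y) 0 n := by
    simp [basisVec]
  rw [h2] at h1
  rcases eq_or_ne n 0 with rfl | hn
  · have h3 : K.edge 0 = Δt := rfl
    rw [h3] at h1
    simp [basisVec] at h1
    rw [Matrix.one_apply_eq]
    have h4 : Δt / 2 * (K.jac (affineMap Δt K.h K.b y) 0 0 - 1) = 0 := by linarith
    rcases mul_eq_zero.1 h4 with h5 | h5 <;> linarith
  · rw [Matrix.one_apply_ne hn.symm]
    simp [basisVec, hn.symm] at h1
    exact h1.resolve_left hpos.ne'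

/-! ### Consequences of the Jacobian bounds on one element. -/

section JacobianBounds

variable {C₁ C₂ : ℝ}

/-- The Jacobian bounds on a single element. -/
def JacBd (K : Element d Δt) (C₁ C₂ : ℝ) : Prop :=
  ∀ z ∈ K.brick, C₁⁻¹ ≤ |(K.jac z).det| ∧ |(K.jac z).det| ≤ C₁ ∧
    ∀ m n : Fin (d + 1), |((K.jac z).submatrix m.succAbove n.succAbove).det| ≤ C₂

/-- A bound on the entries of the Jacobian matrix. -/
noncomputable def entryBd (d : ℕ) (C₁ C₂ : ℝ) : ℝ := C₁ ^ (d - 1) * (d.factorial * C₂ ^ d)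

theorem refCube_nonempty (d : ℕ) : (0 : SpaceTime d) ∈ refCube d := fun j => by simp

/-- The determinant at the centre of the brick is nonzero and at most `C₁` in absolute value. -/
theorem JacBd.pos {K : Element d Δt} (hJ : K.JacBd C₁ C₂) : 0 < C₁ := by
  have hy := refCube_nonempty d
  have h1 := (hJ _ (mem_image_of_mem _ hy)).2.1
  have h2 : (K.jac (affineMap Δt K.h K.b 0)).det ≠ 0 := by
    rw [jac_det]
    exact K.det_ne_zero _ (mem_image_of_mem _ (refCube_subset d hy))
  exact (abs_pos.2 h2).trans_le h1

theorem JacBd.abs_jac_le {K : Element d Δt} (hJ : K.JacBd C₁ C₂) (hd : 1 ≤ d)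
    {z : SpaceTime d} (hz : z ∈ K.brick) (m n : Fin (d + 1)) :
    |K.jac z m n| ≤ entryBd d C₁ C₂ :=
  abs_apply_le_of_minors hd (hJ.pos) (hJ z hz).1 (hJ z hz).2.2 m n

/-- Spatial derivatives on the master element are controlled by the spatial gradient. -/
theorem JacBd.sq_fderiv_comp_le {K : Element d Δt} (hJ : K.JacBd C₁ C₂) (hΔt : 0 < Δt)
    (hd : 1 ≤ d) {V : SpaceTime d → ℝ} {y : SpaceTime d} (hy : y ∈ refCube d)
    (hV : DifferentiableAt ℝ V (K.Φ y)) (i : Fin d) :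
    (2 / K.h i) ^ 2 * (fderiv ℝ (fun y => V (K.Φ y)) y (basisVec i.succ)) ^ 2
      ≤ d * entryBd d C₁ C₂ ^ 2 * ‖spatial (classGrad V (K.Φ y))‖ ^ 2 := by
  have hh := K.h_pos i
  have he : K.edge i.succ = K.h i := by simp [edge]
  have h0 : K.jac (affineMap Δt K.h K.b y) 0 i.succ = 0 := by
    rw [K.jac_zero hΔt hy, Matrix.one_apply_ne (Fin.succ_ne_zero i).symm]
  rw [← mul_pow, K.fderiv_comp_Φ hV, he, ← mul_assoc,
    show 2 / K.h i * (K.h i / 2) = 1 by field_simp, one_mul, Fin.sum_univ_succ, h0, zero_mul,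
    zero_add, norm_spatial_sq]
  have := sq_sum_mul_le (a := fun m : Fin d => K.jac (affineMap Δt K.h K.b y) m.succ i.succ)
    (b := fun m => classGrad V (K.Φ y) m.succ)
    (fun m => hJ.abs_jac_le hd (mem_image_of_mem _ hy) _ _)
  simpa using this

/-- The spatial gradient is controlled by spatial derivatives on the master element. -/
theorem JacBd.norm_spatial_classGrad_le {K : Element d Δt} (hJ : K.JacBd C₁ C₂) (hΔt : 0 < Δt)
    {V : SpaceTime d → ℝ} {y : SpaceTime d} (hy : y ∈ refCube d)
    (hV : DifferentiableAt ℝ V (K.Φ y)) :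
    ‖spatial (classGrad V (K.Φ y))‖ ^ 2 ≤ d * (d * (C₁ * C₂) ^ 2 *
      ∑ i : Fin d, (2 / K.h i) ^ 2 *
        (fderiv ℝ (fun y => V (K.Φ y)) y (basisVec i.succ)) ^ 2) := by
  set J := K.jac (affineMap Δt K.h K.b y) with hJdef
  have hmem : affineMap Δt K.h K.b y ∈ K.brick := mem_image_of_mem _ hy
  have hdet : IsUnit J.det := by
    rw [isUnit_iff_ne_zero, hJdef, jac_det]
    exact K.det_ne_zero _ (mem_image_of_mem _ (refCube_subset d hy))
  set a : Fin (d + 1) → ℝ := fun i =>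
    2 / K.edge i * fderiv ℝ (fun y => V (K.Φ y)) y (basisVec i) with ha
  have hvec : Matrix.vecMul (classGrad V (K.Φ y)) J = a := by
    ext i
    -- Chain rule: after division by the half edge lengths, the derivatives on the master element
    -- form the row vector `∇V · J`.
    have := (K.edge_pos hΔt i).ne'
    rw [ha]
    simp only [K.fderiv_comp_Φ hV i, ← hJdef]
    rw [← mul_assoc, show 2 / K.edge i * (K.edge i / 2) = 1 by field_simp, one_mul]
    simp only [Matrix.vecMul, dotProduct, mul_comm]
  have hG : ∀ m, classGrad V (K.Φ y) m = Matrix.vecMul a J⁻¹ m := by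
    intro m
    rw [← hvec, Matrix.vecMul_vecMul, Matrix.mul_nonsing_inv _ hdet, Matrix.vecMul_one]
  -- Since row `0` of `J` is `(1, 0, …, 0)`, row `0` of `J J⁻¹ = 1` shows that the inverse has the
  -- same row. The time derivative `a 0` thus drops out of the spatial components.
  have hinv : ∀ m : Fin d, J⁻¹ 0 m.succ = 0 := by
    intro m
    have h1 := congrFun (congrFun (Matrix.mul_nonsing_inv J hdet) 0) m.succ
    rw [Matrix.mul_apply, Matrix.one_apply_ne (Fin.succ_ne_zero m).symm] at h1
    simp only [hJdef, K.jac_zero hΔt hy] at h1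
    simpa [Matrix.one_apply] using h1
  rw [norm_spatial_sq]
  calc ∑ m : Fin d, classGrad V (K.Φ y) m.succ ^ 2
      ≤ ∑ _m : Fin d, (d * (C₁ * C₂) ^ 2 * ∑ i : Fin d, a i.succ ^ 2) := by
        refine Finset.sum_le_sum fun m _ => ?_
        rw [hG, Matrix.vecMul, dotProduct, Fin.sum_univ_succ, hinv, mul_zero, zero_add]
        have := sq_sum_mul_le (a := fun i : Fin d => J⁻¹ i.succ m.succ)
          (b := fun i : Fin d => a i.succ)
          (fun i => abs_inv_apply_le (hJ.pos) (hJ _ hmem).1 (hJ _ hmem).2.2 _ _)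
        simpa [mul_comm] using this
    _ = _ := by
        simp only [Finset.sum_const, Finset.card_univ, Fintype.card_fin, nsmul_eq_mul, ha, mul_pow]
        rfl

theorem JacBd.norm_fderiv_le {K : Element d Δt} (hJ : K.JacBd C₁ C₂) (hd : 1 ≤ d)
    {z : SpaceTime d} (hz : z ∈ K.brick) :
    ‖fderiv ℝ K.φ z‖ ≤ (d + 1) * entryBd d C₁ C₂ := by
  have hE : 0 ≤ entryBd d C₁ C₂ := (abs_nonneg _).trans (hJ.abs_jac_le hd hz 0 0)
  refine ContinuousLinearMap.opNorm_le_bound _ (by positivity) fun v => ?_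
  refine le_of_sq_le_sq ?_ (by positivity)
  have hv : v = ∑ n, v n • basisVec n := by
    ext k; simp [basisVec, Pi.single_apply]
  have hcomp : ∀ m, fderiv ℝ K.φ z v m = ∑ n, K.jac z m n * v n := by
    intro m
    conv_lhs => rw [hv]
    simp only [map_sum, map_smul]
    simp [jac, mul_comm]
  rw [EuclideanSpace.norm_sq_eq, mul_pow, EuclideanSpace.norm_sq_eq]
  simp only [Real.norm_eq_abs, sq_abs]
  calc ∑ m, (fderiv ℝ K.φ z v m) ^ 2
      ≤ ∑ _m : Fin (d + 1), ((d + 1) * entryBd d C₁ C₂ ^ 2 * ∑ n, v n ^ 2) := by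
        refine Finset.sum_le_sum fun m _ => ?_
        rw [hcomp]
        have := sq_sum_mul_le (a := fun n => K.jac z m n) (b := fun n => v n)
          (fun n => hJ.abs_jac_le hd hz m n)
        simpa using this
    _ = _ := by
        simp
        ring

theorem JacBd.lipschitzOnWith {K : Element d Δt} (hJ : K.JacBd C₁ C₂)
    (hd : 1 ≤ d) :
    LipschitzOnWith (Real.toNNReal ((d + 1) * entryBd d C₁ C₂)) K.φ
      (affineMap Δt K.h K.b '' refCubeClosed d) := by
  have hconv : Convex ℝ K.brick := by
    have : K.brick = (fun z => K.b + z) '' (K.diagL '' refCube d) := by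
      rw [image_image, brick]
      exact image_congr fun y _ => (K.affineMap_eq y).trans (add_comm _ _)
    rw [this]
    have h1 : Convex ℝ (K.diagL '' refCube d) := (convex_refCube d).linear_image K.diagL.toLinearMap
    exact h1.translate K.b
  have h1 : LipschitzOnWith (Real.toNNReal ((d + 1) * entryBd d C₁ C₂)) K.φ K.brick := by
    refine hconv.lipschitzOnWith_of_nnnorm_fderiv_le (𝕜 := ℝ)
      (fun x _ => K.contDiff.differentiable (by simp) x) fun x hx => ?_
    rw [← norm_toNNReal]
    exact Real.toNNReal_le_toNNReal (hJ.norm_fderiv_le hd hx)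
  -- The derivative bound is available on the open brick only; continuity carries the Lipschitz
  -- bound to its closure, which contains the faces.
  refine (h1.closure K.contDiff.continuous.continuousOn).mono ?_
  exact (image_mono (subset_closure_refCube d)).trans
    (image_closure_subset_closure_image K.contDiff_affineMap.continuous)

end JacobianBounds

end Element

/-! ### Surface measure of the lateral boundary. -/

/-- The hyperplane `z j = c`, parametrized by the other coordinates. -/
noncomputable def insertCoord {d : ℕ} (j : Fin (d + 1)) (c : ℝ) (x : EuclideanSpace ℝ (Fin d)) :
    SpaceTime d :=
  WithLp.toLp 2 (j.insertNth c (fun k => x k))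

theorem isometry_insertCoord {d : ℕ} (j : Fin (d + 1)) (c : ℝ) :
    Isometry (insertCoord j c) := by
  refine Isometry.of_dist_eq fun x y => ?_
  rw [EuclideanSpace.dist_eq, EuclideanSpace.dist_eq, Fin.sum_univ_succAbove _ j]
  simp [insertCoord]

theorem surf_image_le {d : ℕ} {f : SpaceTime d → SpaceTime d} {L : NNReal}
    {s : Set (SpaceTime d)} (hf : LipschitzOnWith L f s) :
    surf d (f '' s) ≤ (L : ENNReal) ^ d * surf d s := by
  have h := hf.hausdorffMeasure_image_le (d := d) (by positivity)
  rw [ENNReal.rpow_natCast] at h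
  simp only [surf, Measure.euclideanHausdorffMeasure_def, Measure.smul_apply]
  rw [ENNReal.smul_def, ENNReal.smul_def, smul_eq_mul, smul_eq_mul, mul_left_comm]
  exact mul_le_mul_right h _

/-- The closed box with centre `b` and edge lengths `e`. -/
def box {d : ℕ} (b e : Fin d → ℝ) : Set (EuclideanSpace ℝ (Fin d)) :=
  {x | ∀ k, x k ∈ Icc (b k - e k / 2) (b k + e k / 2)}

theorem volume_box {d : ℕ} (b e : Fin d → ℝ) :
    volume (box b e) = ∏ k, ENNReal.ofReal (e k) := by
  have h : box b e = WithLp.ofLp ⁻¹' Icc (fun k => b k - e k / 2) (fun k => b k + e k / 2) := by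
    ext x
    simp only [box, mem_ofPred_eq, mem_preimage, mem_Icc, Pi.le_def, forall_and]
  rw [h, (PiLp.volume_preserving_ofLp (Fin d)).measure_preimage measurableSet_Icc.nullMeasurableSet,
    Real.volume_Icc_pi]
  refine Finset.prod_congr rfl fun k _ => ?_
  congr 1; ring

theorem surf_insertCoord_box {d : ℕ} (j : Fin (d + 1)) (c : ℝ) (b e : Fin d → ℝ) :
    surf d (insertCoord j c '' box b e) = ∏ k, ENNReal.ofReal (e k) := by
  rw [surf, (isometry_insertCoord j c).euclideanHausdorffMeasure_image,
    EuclideanSpace.euclideanHausdorffMeasure_eq_volume, volume_box]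

namespace Element

variable {d : ℕ} {Δt : ℝ}

/-- The two faces of the brick orthogonal to the `j`-th axis. -/
noncomputable def brickFace (K : Element d Δt) (j : Fin (d + 1)) (s : ℝ) : Set (SpaceTime d) :=
  affineMap Δt K.h K.b '' {y ∈ refCubeClosed d | y j = s}

theorem surf_brickFace_le (K : Element d Δt) (hΔt : 0 < Δt) (j : Fin (d + 1)) (s : ℝ) :
    surf d (K.brickFace j s) ≤ ENNReal.ofReal ((∏ k, K.edge k) / K.edge j) := by
  have hsub : K.brickFace j s ⊆ insertCoord j (K.edge j / 2 * s + K.b j) ''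
      box (fun k => K.b (j.succAbove k)) (fun k => K.edge (j.succAbove k)) := by
    rintro _ ⟨y, ⟨hy, hys⟩, rfl⟩
    refine ⟨WithLp.toLp 2 fun k => affineMap Δt K.h K.b y (j.succAbove k), fun k => ?_, ?_⟩
    · have h1 := hy (j.succAbove k)
      have h2 := K.edge_pos hΔt (j.succAbove k)
      simp only [affineMap_apply]
      constructor <;> nlinarith [h1.1, h1.2]
    · ext i
      refine Fin.succAboveCases j ?_ (fun k => ?_) i
      · simp [insertCoord, affineMap_apply, hys]
      · simp [insertCoord]
  refine (measure_mono hsub).trans ?_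
  rw [surf_insertCoord_box, ← ENNReal.ofReal_prod_of_nonneg fun k _ => (K.edge_pos hΔt _).le,
    Fin.prod_univ_succAbove _ j, mul_div_cancel_left₀ _ (K.edge_pos hΔt j).ne']

/-- A boundary point comes from a point of the closed cube with some coordinate `±1`. This cannot be
the time coordinate, for the image would then lie at an end of the time slab. -/
theorem Q_subset (K : Element d Δt) (hΔt : 0 < Δt) :
    K.Q ⊆ ⋃ i : Fin d, (K.φ '' K.brickFace i.succ 1 ∪ K.φ '' K.brickFace i.succ (-1)) := by
  rintro z ⟨hzf, hzt⟩
  have hcl : closure K.carrier ⊆ K.Φ '' refCubeClosed d := by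
    refine closure_minimal ?_
      ((isCompact_refCubeClosed d).image K.contDiff_Φ.continuous).isClosed
    rw [carrier_eq]
    exact image_mono (refCube_subset d)
  rw [(K.isOpen_carrier hΔt).frontier_eq] at hzf
  obtain ⟨y, hy, rfl⟩ := hcl hzf.1
  have hyn : y ∉ refCube d := fun h => hzf.2 (K.carrier_eq ▸ mem_image_of_mem _ h)
  simp only [refCube, mem_ofPred_eq, not_forall] at hyn
  obtain ⟨j, hj⟩ := hyn
  have hj' : y j = 1 ∨ y j = -1 := by
    by_contra hcon
    push Not at hcon
    exact hj ⟨lt_of_le_of_ne (hy j).1 hcon.2.symm, lt_of_le_of_ne (hy j).2 hcon.1⟩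
  have hj0 : j ≠ 0 := by
    rintro rfl
    simp only [mem_ofPred_eq, K.Φ_time hy, K.b_time, mem_Ioo] at hzt
    rcases hj' with h | h <;> rw [h] at hzt <;> linarith [hzt.1, hzt.2]
  obtain ⟨i, rfl⟩ := Fin.exists_succ_eq.2 hj0
  rw [mem_iUnion]
  refine ⟨i, ?_⟩
  rcases hj' with h | h
  · exact Or.inl ⟨_, ⟨y, ⟨hy, h⟩, rfl⟩, rfl⟩
  · exact Or.inr ⟨_, ⟨y, ⟨hy, h⟩, rfl⟩, rfl⟩

variable {C₁ C₂ : ℝ}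

/-- The bound on the Lipschitz constant of `φ`. -/
noncomputable def lipBd (d : ℕ) (C₁ C₂ : ℝ) : NNReal := Real.toNNReal ((d + 1) * entryBd d C₁ C₂)

/-- Each spatial direction contributes two flat faces of area at most `∏ edge / h_i`, and `φ`
stretches areas by at most the `d`-th power of its Lipschitz constant. -/
theorem JacBd.surf_Q_le {K : Element d Δt} (hJ : K.JacBd C₁ C₂) (hΔt : 0 < Δt) (hd : 1 ≤ d) :
    surf d K.Q ≤
      ENNReal.ofReal (∑ i : Fin d, 2 * lipBd d C₁ C₂ ^ d * ((∏ k, K.edge k) / K.h i)) := by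
  have hface : ∀ (i : Fin d) (s : ℝ), surf d (K.φ '' K.brickFace i.succ s) ≤
      ENNReal.ofReal (lipBd d C₁ C₂ ^ d * ((∏ k, K.edge k) / K.h i)) := by
    intro i s
    have hsub : K.brickFace i.succ s ⊆ affineMap Δt K.h K.b '' refCubeClosed d :=
      image_mono fun y hy => hy.1
    refine (surf_image_le ((hJ.lipschitzOnWith hd).mono hsub)).trans ?_
    rw [ENNReal.ofReal_mul (by positivity), ENNReal.ofReal_pow NNReal.zero_le_coe,
      ENNReal.ofReal_coe_nnreal]
    exact mul_le_mul_right (K.surf_brickFace_le hΔt i.succ s) _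
  have hnn : ∀ i : Fin d, 0 ≤ (lipBd d C₁ C₂ : ℝ) ^ d * ((∏ k, K.edge k) / K.h i) := fun i =>
    mul_nonneg (by positivity) (div_nonneg (Finset.prod_nonneg fun k _ => (K.edge_pos hΔt k).le)
      (K.h_pos i).le)
  calc surf d K.Q ≤ surf d (⋃ i : Fin d,
        (K.φ '' K.brickFace i.succ 1 ∪ K.φ '' K.brickFace i.succ (-1))) :=
        measure_mono (K.Q_subset hΔt)
    _ ≤ ∑ i : Fin d, surf d (K.φ '' K.brickFace i.succ 1 ∪ K.φ '' K.brickFace i.succ (-1)) :=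
        measure_iUnion_fintype_le _ _
    _ ≤ ∑ i : Fin d, ENNReal.ofReal (2 * lipBd d C₁ C₂ ^ d * ((∏ k, K.edge k) / K.h i)) := by
        refine Finset.sum_le_sum fun i _ => (measure_union_le _ _).trans ?_
        refine (add_le_add (hface i 1) (hface i (-1))).trans_eq ?_
        rw [← ENNReal.ofReal_add (hnn i) (hnn i)]
        congr 1; ring
    _ = _ := by
        rw [ENNReal.ofReal_sum_of_nonneg]
        intro i _
        have := hnn i
        linarith

theorem hK_nonneg (K : Element d Δt) : 0 ≤ K.hK := by unfold hK; positivity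

theorem hK_pos (K : Element d Δt) (hd : 1 ≤ d) : 0 < K.hK := by
  unfold hK
  have : 0 < ∑ i, K.h i ^ 2 :=
    Finset.sum_pos (fun i _ => pow_pos (K.h_pos i) 2) ⟨⟨0, hd⟩, Finset.mem_univ _⟩
  positivity

theorem hK_le (K : Element d Δt) {cr : ℝ} (hcr : K.hK / K.rhoK ≤ cr) (i : Fin d) :
    K.hK ≤ cr / 2 * K.h i := by
  have : Nonempty (Fin d) := ⟨i⟩
  obtain ⟨j, hj⟩ := exists_eq_ciInf_of_finite (f := K.h)
  have hpos : 0 < K.rhoK := by unfold rhoK; rw [← hj]; exact half_pos (K.h_pos j)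
  have hcr0 : 0 ≤ cr := (div_nonneg K.hK_nonneg hpos.le).trans hcr
  have hle : K.rhoK ≤ K.h i / 2 := by
    unfold rhoK
    have := ciInf_le (Set.finite_range K.h).bddBelow i
    linarith
  calc K.hK ≤ cr * K.rhoK := (div_le_iff₀ hpos).1 hcr
    _ ≤ cr * (K.h i / 2) := mul_le_mul_of_nonneg_left hle hcr0
    _ = _ := by ring

theorem JacBd.surf_Q_lt_top {K : Element d Δt} (hJ : K.JacBd C₁ C₂) (hΔt : 0 < Δt) (hd : 1 ≤ d) :
    surf d K.Q < ⊤ := (hJ.surf_Q_le hΔt hd).trans_lt ENNReal.ofReal_lt_top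

/-- By shape regularity `h_K ≤ (cr/2) h_i`, which cancels the `h_i` in the face areas and leaves the
brick volume, with a constant independent of `Δt`. -/
theorem JacBd.hK_mul_surf_Q_le {K : Element d Δt} (hJ : K.JacBd C₁ C₂) (hΔt : 0 < Δt)
    (hd : 1 ≤ d) {cr : ℝ} (hcr : K.hK / K.rhoK ≤ cr) :
    K.hK * (surf d).real K.Q ≤ d * (cr * lipBd d C₁ C₂ ^ d) * ∏ k, K.edge k := by
  have hprod : 0 < ∏ k, K.edge k := Finset.prod_pos fun k _ => K.edge_pos hΔt k
  have h1 : (surf d).real K.Q ≤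
      ∑ i : Fin d, 2 * lipBd d C₁ C₂ ^ d * ((∏ k, K.edge k) / K.h i) :=
    ENNReal.toReal_le_of_le_ofReal (Finset.sum_nonneg fun i _ => by
      have := K.h_pos i
      positivity) (hJ.surf_Q_le hΔt hd)
  refine (mul_le_mul_of_nonneg_left h1 K.hK_nonneg).trans ?_
  rw [Finset.mul_sum]
  calc ∑ i : Fin d, K.hK * (2 * lipBd d C₁ C₂ ^ d * ((∏ k, K.edge k) / K.h i))
      ≤ ∑ _i : Fin d, cr * lipBd d C₁ C₂ ^ d * ∏ k, K.edge k := by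
        refine Finset.sum_le_sum fun i _ => ?_
        have hi := K.h_pos i
        calc K.hK * (2 * lipBd d C₁ C₂ ^ d * ((∏ k, K.edge k) / K.h i))
            ≤ (cr / 2 * K.h i) * (2 * lipBd d C₁ C₂ ^ d * ((∏ k, K.edge k) / K.h i)) :=
              mul_le_mul_of_nonneg_right (K.hK_le hcr i) (by positivity)
          _ = _ := by field_simp
    _ = _ := by simp; ring

/-- Functions that are polynomial on the master element coincide with a `C¹` function. -/
theorem ae_eq_homeo_symm (K : Element d Δt) (hΔt : 0 < Δt) {v p : SpaceTime d → ℝ}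
    (h : ∀ᵐ y ∂(volume.restrict (refCube d)), v (K.Φ y) = p y) :
    v =ᵐ[volume.restrict K.carrier] fun z => p ((K.homeo hΔt).symm z) := by
  rw [ae_restrict_iff' (isOpen_refCube d).measurableSet] at h
  rw [Filter.EventuallyEq, ae_restrict_iff' (K.isOpen_carrier hΔt).measurableSet]
  set N : Set (SpaceTime d) := {y | ¬(y ∈ refCube d → v (K.Φ y) = p y)}
  have hN : volume N = 0 := h
  -- A differentiable map of the space to itself sends null sets to null sets.
  have hΦN : volume (K.Φ '' N) = 0 :=
    addHaar_image_eq_zero_of_differentiableOn_of_addHaar_eq_zero volume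
      (K.contDiff_Φ.differentiable (by simp)).differentiableOn hN
  refine measure_mono_null (fun z hz => ?_) hΦN
  simp only [mem_compl_iff, mem_ofPred_eq, Classical.not_imp] at hz
  refine ⟨(K.homeo hΔt).symm z, ?_, K.Φ_homeo_symm hΔt hz.1⟩
  simp only [N, mem_ofPred_eq, Classical.not_imp, K.Φ_homeo_symm hΔt hz.1]
  exact ⟨K.homeo_symm_mem hΔt hz.1, hz.2⟩

theorem JacBd.setIntegral_comp_Φ_le {K : Element d Δt} (hJ : K.JacBd C₁ C₂) (hΔt : 0 < Δt)
    {f : SpaceTime d → ℝ} (hf : ∀ z, 0 ≤ f z) (hfi : IntegrableOn f K.carrier) :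
    IntegrableOn (fun y => f (K.Φ y)) (refCube d) ∧
    (∏ j, K.edge j / 2) * ∫ y in refCube d, f (K.Φ y) ≤ C₁ * ∫ z in K.carrier, f z := by
  have hC₁ := hJ.pos
  have hprod : 0 < ∏ j, K.edge j / 2 := Finset.prod_pos fun j _ => by
    have := K.edge_pos hΔt j; positivity
  have hms := (isOpen_refCube d).measurableSet
  have hder : ∀ y ∈ refCube d, HasFDerivWithinAt K.Φ
      ((fderiv ℝ K.φ (affineMap Δt K.h K.b y)).comp K.diagL) (refCube d) y :=
    fun y _ => (K.hasFDerivAt_Φ y).hasFDerivWithinAt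
  have hinj : InjOn K.Φ (refCube d) := (K.injOn_Φ hΔt).mono (refCube_subset d)
  rw [K.carrier_eq] at hfi ⊢
  have hint := (integrableOn_image_iff_integrableOn_abs_det_fderiv_smul volume hms hder hinj f).1 hfi
  have hchg := integral_image_eq_integral_abs_det_fderiv_smul volume hms hder hinj f
  have hdet : ∀ y ∈ refCube d, (∏ j, K.edge j / 2) * C₁⁻¹ ≤
      |((fderiv ℝ K.φ (affineMap Δt K.h K.b y)).comp K.diagL).det| := by
    intro y hy
    rw [fderiv_Φ_det, abs_mul, abs_of_pos hprod, mul_comm]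
    exact mul_le_mul_of_nonneg_right (hJ _ (mem_image_of_mem _ hy)).1 hprod.le
  set c := (∏ j, K.edge j / 2) * C₁⁻¹ with hc
  have hcpos : 0 < c := by positivity
  -- The change of variables gives measurability only of the product with the determinant; dividing
  -- by that continuous nonvanishing factor recovers `f ∘ Φ`.
  have hmeas : AEStronglyMeasurable (fun y => f (K.Φ y)) (volume.restrict (refCube d)) := by
    have hcont : ContinuousOn (fun y =>
        |((fderiv ℝ K.φ (affineMap Δt K.h K.b y)).comp K.diagL).det|⁻¹) (refCube d) := by
      refine ContinuousOn.inv₀ ?_ fun y hy => (hcpos.trans_le (hdet y hy)).ne'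
      refine Continuous.continuousOn (continuous_abs.comp ?_)
      refine ContinuousLinearMap.continuous_det.comp ?_
      exact ((K.contDiff.continuous_fderiv (by simp)).comp
        K.contDiff_affineMap.continuous).clm_comp continuous_const
    refine ((hcont.aestronglyMeasurable hms).smul hint.aestronglyMeasurable).congr ?_
    filter_upwards [ae_restrict_mem hms] with y hy
    have := hcpos.trans_le (hdet y hy)
    simp only [Pi.smul_apply', smul_eq_mul]
    rw [inv_mul_cancel_left₀ this.ne']
  have hle : ∀ᵐ y ∂(volume.restrict (refCube d)), c * f (K.Φ y) ≤
      |((fderiv ℝ K.φ (affineMap Δt K.h K.b y)).comp K.diagL).det| • f (K.Φ y) := by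
    filter_upwards [ae_restrict_mem hms] with y hy
    exact mul_le_mul_of_nonneg_right (hdet y hy) (hf _)
  have hci : Integrable (fun y => c * f (K.Φ y)) (volume.restrict (refCube d)) := by
    refine Integrable.mono' hint (hmeas.const_mul c) ?_
    filter_upwards [hle] with y hy
    rwa [Real.norm_of_nonneg (mul_nonneg hcpos.le (hf _))]
  have hfΦ : IntegrableOn (fun y => f (K.Φ y)) (refCube d) :=
    (integrable_const_mul_iff (isUnit_iff_ne_zero.2 hcpos.ne') _).1 hci
  refine ⟨hfΦ, ?_⟩
  rw [hchg]
  have h1 := integral_mono_ae hci hint hle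
  rw [integral_const_mul] at h1
  calc (∏ j, K.edge j / 2) * ∫ y in refCube d, f (K.Φ y)
      = C₁ * (c * ∫ y in refCube d, f (K.Φ y)) := by rw [hc]; field_simp
    _ ≤ _ := mul_le_mul_of_nonneg_left h1 hC₁.le

end Element

/-! ### Inverse estimate and discrete trace inequality. -/

theorem weakGrad_coord_memLp {d : ℕ} (U : Set (SpaceTime d)) (u : SpaceTime d → ℝ)
    (j : Fin (d + 1)) : MemLp (fun z => weakGrad U u z j) 2 (volume.restrict U) :=
  (weakGrad_memLp U u).continuousLinearMap_comp (EuclideanSpace.proj (𝕜 := ℝ) j)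

theorem spatial_weakGrad_memLp {d : ℕ} (U : Set (SpaceTime d)) (u : SpaceTime d → ℝ) :
    MemLp (fun z => spatial (weakGrad U u z)) 2 (volume.restrict U) :=
  (weakGrad_memLp U u).continuousLinearMap_comp (spatialL d)

theorem integrable_norm_spatial_weakGrad_sq {d : ℕ} (U : Set (SpaceTime d))
    (u : SpaceTime d → ℝ) :
    Integrable (fun z => ‖spatial (weakGrad U u z)‖ ^ 2) (volume.restrict U) :=
  (spatial_weakGrad_memLp U u).integrable_norm_pow (by norm_num)

namespace Element

variable {d : ℕ} {Δt : ℝ}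

/-- The restriction of `v` to the element is a polynomial on the master element. -/
def IsPoly (K : Element d Δt) (pt ps : ℕ) (v : SpaceTime d → ℝ) : Prop :=
  ∃ q : MvPolynomial (Fin (d + 1)) ℝ, IsTensorPoly pt ps q ∧
    ∀ᵐ y ∂(volume.restrict (refCube d)), v (K.Φ y) = MvPolynomial.eval (fun j => y j) q

/-- Inverse estimate: the maximum norm of the spatial gradient of a discrete function is controlled
by the mean of its square. -/
theorem exists_norm_spatial_weakGrad_le (hd : 1 ≤ d) (pt ps : ℕ) (C₁ C₂ : ℝ) :
    ∃ C : ℝ, 0 ≤ C ∧ ∀ (Δt : ℝ) (K : Element d Δt), 0 < Δt → K.JacBd C₁ C₂ →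
      ∀ v, K.IsPoly pt ps v → ∀ᵐ z ∂(volume.restrict K.carrier),
        (∏ k, K.edge k) * ‖spatial (weakGrad K.carrier v z)‖ ^ 2
          ≤ C * ∫ z in K.carrier, ‖spatial (weakGrad K.carrier v z)‖ ^ 2 := by
  obtain ⟨Cp, hCp, hpoly⟩ := exists_sq_eval_le d (max pt ps)
  by_cases hC₁ : 0 < C₁
  swap
  · exact ⟨0, le_rfl, fun Δt K _ hJ => absurd hJ.pos hC₁⟩
  set E := entryBd d C₁ C₂
  -- From the inside out: `d * E²` passes from master derivatives to the gradient on the element,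
  -- `Cp` from mean to maximum, the next `d` sums over directions, `d * (d * (C₁ C₂)²)` returns to
  -- the gradient, `2^(d+1)` turns half edges into edges, and `C₁` comes from the change of
  -- variables.
  refine ⟨2 ^ (d + 1) * (d * (d * (C₁ * C₂) ^ 2 * (d * (Cp * (d * E ^ 2))))) * C₁, by positivity,
    fun Δt K hΔt hJ v hv => ?_⟩
  rcases weakGrad_spec K.carrier v with hw | hw
  swap
  · have h0 : spatial (0 : SpaceTime d) = 0 := map_zero (spatialL d)
    simp [hw, h0]
  obtain ⟨q, hq, hvq⟩ := hv
  set p : SpaceTime d → ℝ := fun y => MvPolynomial.eval (fun j => y j) q with hp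
  set V : SpaceTime d → ℝ := fun z => p ((K.homeo hΔt).symm z) with hV
  have hVc : ContDiffOn ℝ 1 V K.carrier :=
    (contDiff_eval_coord q).comp_contDiffOn (K.contDiffOn_homeo_symm hΔt)
  have hopen := K.isOpen_carrier hΔt
  have hgrad := hw.ae_eq_fderiv hopen hVc (K.ae_eq_homeo_symm hΔt hvq)
  have hgrad' : ∀ᵐ z ∂(volume.restrict K.carrier), weakGrad K.carrier v z = classGrad V z := by
    filter_upwards [hgrad] with z hz
    ext j
    exact hz j
  have hΦmem : ∀ y ∈ refCube d, K.Φ y ∈ K.carrier := fun y hy =>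
    K.carrier_eq ▸ mem_image_of_mem _ hy
  have hVd : ∀ y ∈ refCube d, DifferentiableAt ℝ V (K.Φ y) := fun y hy =>
    (hVc.contDiffAt (hopen.mem_nhds (hΦmem y hy))).differentiableAt (by simp)
  have hfd : ∀ y ∈ refCube d, ∀ i, fderiv ℝ (fun y => V (K.Φ y)) y (basisVec i)
      = MvPolynomial.eval (fun j => y j) (MvPolynomial.pderiv i q) := by
    intro y hy i
    have : (fun y => V (K.Φ y)) =ᶠ[𝓝 y] p := by
      filter_upwards [(isOpen_refCube d).mem_nhds hy] with x hx
      simp only [hV, K.homeo_symm_Φ hΔt hx]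
    rw [this.fderiv_eq, fderiv_eval_coord]
  set G : SpaceTime d → ℝ := fun z => ‖spatial (classGrad V z)‖ ^ 2 with hG
  have hGi : IntegrableOn G K.carrier := by
    refine (integrable_norm_spatial_weakGrad_sq K.carrier v).congr ?_
    filter_upwards [hgrad'] with z hz
    rw [hz]
  have hGeq : ∫ z in K.carrier, ‖spatial (weakGrad K.carrier v z)‖ ^ 2 = ∫ z in K.carrier, G z := by
    refine integral_congr_ae ?_
    filter_upwards [hgrad'] with z hz
    rw [hz]
  obtain ⟨hGΦ, hGle⟩ := hJ.setIntegral_comp_Φ_le hΔt (fun z => sq_nonneg _) hGi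
  set I := ∫ y in refCube d, G (K.Φ y) with hI
  -- The weight `(2/h_i)²` is kept with each derivative: it enters and leaves through the two
  -- gradient comparisons, so the edge lengths never have to be compared.
  have hderiv : ∀ y ∈ refCube d, ∀ i : Fin d,
      (2 / K.h i) ^ 2 * (fderiv ℝ (fun y => V (K.Φ y)) y (basisVec i.succ)) ^ 2
        ≤ Cp * (d * E ^ 2) * I := by
    intro y hy i
    rw [hfd y hy]
    have hi := K.h_pos i
    have h1 := hpoly _ (hq.pderiv_mem i.succ) y hy
    have h2 : (2 / K.h i) ^ 2 * ∫ y in refCube d,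
        (MvPolynomial.eval (fun j => y j) (MvPolynomial.pderiv i.succ q)) ^ 2
          ≤ d * E ^ 2 * I := by
      rw [← integral_const_mul, hI, ← integral_const_mul]
      refine integral_mono_ae ((memLp_eval_refCube _).integrable_sq.const_mul _)
        (hGΦ.const_mul _) ?_
      filter_upwards [ae_restrict_mem (isOpen_refCube d).measurableSet] with x hx
      have := hJ.sq_fderiv_comp_le hΔt hd hx (hVd x hx) i
      rwa [hfd x hx] at this
    calc (2 / K.h i) ^ 2 *
          (MvPolynomial.eval (fun j => y j) (MvPolynomial.pderiv i.succ q)) ^ 2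
        ≤ (2 / K.h i) ^ 2 * (Cp * ∫ y in refCube d,
          (MvPolynomial.eval (fun j => y j) (MvPolynomial.pderiv i.succ q)) ^ 2) :=
          mul_le_mul_of_nonneg_left h1 (by positivity)
      _ = Cp * ((2 / K.h i) ^ 2 * ∫ y in refCube d,
          (MvPolynomial.eval (fun j => y j) (MvPolynomial.pderiv i.succ q)) ^ 2) := by ring
      _ ≤ Cp * (d * E ^ 2 * I) := mul_le_mul_of_nonneg_left h2 hCp
      _ = _ := by ring
  filter_upwards [hgrad', ae_restrict_mem hopen.measurableSet] with z hz hzK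
  rw [hGeq, hz]
  set y := (K.homeo hΔt).symm z with hy
  have hyc : y ∈ refCube d := K.homeo_symm_mem hΔt hzK
  have hzy : K.Φ y = z := K.Φ_homeo_symm hΔt hzK
  have hmain : ‖spatial (classGrad V z)‖ ^ 2
      ≤ d * (d * (C₁ * C₂) ^ 2 * (d * (Cp * (d * E ^ 2)))) * I := by
    have h1 := hJ.norm_spatial_classGrad_le hΔt hyc (hVd y hyc)
    rw [hzy] at h1
    refine h1.trans ?_
    have h2 : ∑ i : Fin d, (2 / K.h i) ^ 2 *
        (fderiv ℝ (fun y => V (K.Φ y)) y (basisVec i.succ)) ^ 2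
          ≤ ∑ _i : Fin d, Cp * (d * E ^ 2) * I :=
      Finset.sum_le_sum fun i _ => hderiv y hyc i
    rw [Finset.sum_const, Finset.card_univ, Fintype.card_fin, nsmul_eq_mul] at h2
    calc _ ≤ d * (d * (C₁ * C₂) ^ 2 * (d * (Cp * (d * E ^ 2) * I))) := by gcongr
      _ = _ := by ring
  have hprod : ∏ k, K.edge k = 2 ^ (d + 1) * ∏ k, K.edge k / 2 := by
    rw [Finset.prod_div_distrib]; simp; field_simp
  have hpos : 0 ≤ ∏ k, K.edge k / 2 := Finset.prod_nonneg fun k _ => by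
    have := K.edge_pos hΔt k; positivity
  set P := ∏ k, K.edge k / 2
  set A := (d : ℝ) * (d * (C₁ * C₂) ^ 2 * (d * (Cp * (d * E ^ 2))))
  have hA : 0 ≤ A := by positivity
  rw [hprod]
  calc 2 ^ (d + 1) * P * ‖spatial (classGrad V z)‖ ^ 2
      ≤ 2 ^ (d + 1) * P * (A * I) := mul_le_mul_of_nonneg_left hmain (by positivity)
    _ = 2 ^ (d + 1) * A * (P * I) := by ring
    _ ≤ 2 ^ (d + 1) * A * (C₁ * ∫ z in K.carrier, G z) :=
        mul_le_mul_of_nonneg_left hGle (by positivity)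
    _ = _ := by ring

/-- The normal component of the trace of the spatial gradient. -/
noncomputable def normalDer (K : Element d Δt) (v : SpaceTime d → ℝ) (z : SpaceTime d) : ℝ :=
  inner ℝ (spatial (trace K.carrier (weakGrad K.carrier v) z)) (spatial (outerNormal K.carrier z))

theorem abs_normalDer_le (K : Element d Δt) (v : SpaceTime d → ℝ) :
    ∀ᵐ z ∂((surf d).restrict (frontier K.carrier)),
      |K.normalDer v z| ≤ ‖spatial (trace K.carrier (weakGrad K.carrier v) z)‖ := by
  filter_upwards [outerNormal_norm_le K.carrier] with z hz
  refine (abs_real_inner_le_norm _ _).trans ?_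
  exact mul_le_of_le_one_right (norm_nonneg _) ((norm_spatial_le _).trans hz)

theorem normalDer_memLp (K : Element d Δt) (v : SpaceTime d → ℝ) :
    MemLp (K.normalDer v) 2 ((surf d).restrict (frontier K.carrier)) := by
  have h1 : MemLp (fun z => spatial (trace K.carrier (weakGrad K.carrier v) z)) 2
      ((surf d).restrict (frontier K.carrier)) :=
    (trace_memLp K.carrier (weakGrad K.carrier v)).continuousLinearMap_comp (spatialL d)
  refine h1.of_le (h1.aestronglyMeasurable.inner
    ((spatialL d).continuous.comp_aestronglyMeasurable
      (outerNormal_aestronglyMeasurable K.carrier))) ?_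
  filter_upwards [K.abs_normalDer_le v] with z hz using hz

/-- Discrete trace inequality for the normal derivative on the lateral boundary. -/
theorem exists_trace_inequality (hd : 1 ≤ d) (pt ps : ℕ) (C₁ C₂ cr : ℝ) :
    ∃ C : ℝ, 0 ≤ C ∧ ∀ (Δt : ℝ) (K : Element d Δt), 0 < Δt → K.JacBd C₁ C₂ →
      K.hK / K.rhoK ≤ cr → ∀ v, K.IsPoly pt ps v →
        K.hK * ∫ z in K.Q, K.normalDer v z ^ 2 ∂(surf d)
          ≤ C * ∫ z in K.carrier, ‖spatial (weakGrad K.carrier v z)‖ ^ 2 := by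
  obtain ⟨C, hC, hinv⟩ := exists_norm_spatial_weakGrad_le hd pt ps C₁ C₂
  -- The maximum with `0` keeps the constant nonnegative for every real `cr`.
  refine ⟨max 0 (d * (cr * lipBd d C₁ C₂ ^ d)) * C, by positivity,
    fun Δt K hΔt hJ hcr v hv => ?_⟩
  set I := ∫ z in K.carrier, ‖spatial (weakGrad K.carrier v z)‖ ^ 2
  have hI : 0 ≤ I := integral_nonneg fun z => by positivity
  set P := ∏ k, K.edge k
  have hP : 0 < P := Finset.prod_pos fun k _ => K.edge_pos hΔt k
  have hCIP : 0 ≤ C * I / P := div_nonneg (mul_nonneg hC hI) hP.le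
  have hbd : ∀ᵐ z ∂(volume.restrict K.carrier),
      ‖spatial (weakGrad K.carrier v z)‖ ≤ Real.sqrt (C * I / P) := by
    filter_upwards [hinv Δt K hΔt hJ v hv] with z hz
    apply Real.le_sqrt_of_sq_le
    rw [le_div_iff₀ hP, mul_comm]
    exact hz
  -- The almost everywhere bound in the interior passes to the trace, so the integral over `𝒬` is at
  -- most this bound squared times the area of `𝒬`.
  have htr := norm_spatial_trace_le (K.isOpen_carrier hΔt) (Real.sqrt_nonneg _) hbd
  have hQ : ∀ᵐ z ∂((surf d).restrict K.Q), ‖K.normalDer v z ^ 2‖ ≤ C * I / P := by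
    refine ae_mono (Measure.restrict_mono (inter_subset_left : K.Q ⊆ frontier K.carrier) le_rfl) ?_
    filter_upwards [htr, K.abs_normalDer_le v] with z h1 h2
    rw [norm_pow, Real.norm_eq_abs]
    calc |K.normalDer v z| ^ 2 ≤ Real.sqrt (C * I / P) ^ 2 :=
          pow_le_pow_left₀ (abs_nonneg _) (h2.trans h1) 2
      _ = _ := Real.sq_sqrt hCIP
  have h1 := norm_setIntegral_le_of_norm_le_const_ae (hJ.surf_Q_lt_top hΔt hd) hQ
  have h2 := (Real.le_norm_self _).trans h1
  have h3 := hJ.hK_mul_surf_Q_le hΔt hd hcr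
  calc K.hK * ∫ z in K.Q, K.normalDer v z ^ 2 ∂(surf d)
      ≤ K.hK * (C * I / P * (surf d).real K.Q) := mul_le_mul_of_nonneg_left h2 K.hK_nonneg
    _ = C * I / P * (K.hK * (surf d).real K.Q) := by ring
    _ ≤ C * I / P * (d * (cr * lipBd d C₁ C₂ ^ d) * P) :=
        mul_le_mul_of_nonneg_left h3 hCIP
    _ = d * (cr * lipBd d C₁ C₂ ^ d) * (C * I) := by field_simp
    _ ≤ max 0 (d * (cr * lipBd d C₁ C₂ ^ d)) * (C * I) :=
        mul_le_mul_of_nonneg_right (le_max_right _ _) (mul_nonneg hC hI)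
    _ = _ := by ring

end Element

/-! ### Weighted Cauchy-Schwarz inequalities and the upwind value. -/

section CauchySchwarz

variable {X : Type*} [MeasurableSpace X] {m : Measure X} {f g : X → ℝ}

theorem integrable_abs_mul_abs (hf : MemLp f 2 m) (hg : MemLp g 2 m) :
    Integrable (fun x => |f x| * |g x|) m :=
  MemLp.integrable_mul (p := 2) (q := 2) hf.norm hg.norm

theorem integral_abs_mul_abs_le (hf : MemLp f 2 m) (hg : MemLp g 2 m) :
    ∫ x, |f x| * |g x| ∂m ≤ Real.sqrt (∫ x, f x ^ 2 ∂m) * Real.sqrt (∫ x, g x ^ 2 ∂m) := by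
  have h := integral_mul_le_Lp_mul_Lq_of_nonneg (μ := m) Real.HolderConjugate.two_two
    (f := fun x => |f x|) (g := fun x => |g x|)
    (Eventually.of_forall fun x => abs_nonneg _) (Eventually.of_forall fun x => abs_nonneg _)
    (by simpa using hf.norm) (by simpa using hg.norm)
  simpa [Real.sqrt_eq_rpow] using h

theorem abs_integral_le_sqrt_mul_sqrt {F : X → ℝ} (hf : MemLp f 2 m) (hg : MemLp g 2 m)
    (hF : ∀ᵐ x ∂m, |F x| ≤ |f x| * |g x|) :
    |∫ x, F x ∂m| ≤ Real.sqrt (∫ x, f x ^ 2 ∂m) * Real.sqrt (∫ x, g x ^ 2 ∂m) := by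
  rw [← Real.norm_eq_abs]
  exact (norm_integral_le_of_norm_le (integrable_abs_mul_abs hf hg) hF).trans
    (integral_abs_mul_abs_le hf hg)

/-- Splitting `|b|` as `√|b| · √|b|` lets boundary terms be estimated in the weighted norms.
Boundedness of `b` serves only for integrability, so its size does not enter the constants. -/
theorem memLp_sqrt_abs_mul {b : X → ℝ} (hb : MemLp b ⊤ m) (hf : MemLp f 2 m) :
    MemLp (fun x => Real.sqrt |b x| * f x) 2 m := by
  have h1 : MemLp (fun x => Real.sqrt |b x|) ⊤ m := by
    refine (hb.norm.add (memLp_top_const (1 : ℝ))).of_le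
      (Real.continuous_sqrt.comp_aestronglyMeasurable hb.aestronglyMeasurable.norm) ?_
    filter_upwards with x
    have h0 := abs_nonneg (b x)
    simp only [Pi.add_apply, Real.norm_eq_abs]
    rw [abs_of_nonneg (Real.sqrt_nonneg _), abs_of_nonneg (a := |b x| + 1) (by positivity)]
    exact Real.sqrt_le_iff.2 ⟨by positivity, by nlinarith⟩
  exact MemLp.mul (p := ⊤) (q := 2) (r := 2) hf h1

theorem sqrt_abs_mul_sq (b a : ℝ) : (Real.sqrt |b| * a) ^ 2 = |b| * a ^ 2 := by
  rw [mul_pow, Real.sq_sqrt (abs_nonneg b)]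

/-- The upwind value: `u` where `b` is positive and `l` elsewhere. -/
noncomputable def upwind (b u l : ℝ) : ℝ := if 0 < b then u else l

theorem measurable_upwind : Measurable fun p : ℝ × ℝ × ℝ => upwind p.1 p.2.1 p.2.2 :=
  Measurable.ite (measurableSet_lt measurable_const measurable_fst)
    (measurable_fst.comp measurable_snd) (measurable_snd.comp measurable_snd)

theorem memLp_upwind {b u l : X → ℝ} (hb : AEMeasurable b m) (hu : MemLp u 2 m)
    (hl : MemLp l 2 m) : MemLp (fun x => upwind (b x) (u x) (l x)) 2 m := by
  refine (hu.norm.add hl.norm).of_le (measurable_upwind.comp_aemeasurable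
    (hb.prodMk (hu.aemeasurable.prodMk hl.aemeasurable))).aestronglyMeasurable ?_
  filter_upwards with x
  simp only [Pi.add_apply, Real.norm_eq_abs]
  rw [abs_of_nonneg (a := |u x| + |l x|) (by positivity)]
  unfold upwind
  split_ifs
  · linarith [abs_nonneg (l x)]
  · linarith [abs_nonneg (u x)]

/-- For `b > 0` the flux collapses to `b u`, otherwise to `b l`. -/
theorem upwind_flux (b u l : ℝ) :
    |1 / 2 * (b * (u + l) + |b| * (u - l))| = |b| * |upwind b u l| := by
  unfold upwind
  split_ifs with h
  · rw [abs_of_pos h, show 1 / 2 * (b * (u + l) + b * (u - l)) = b * u by ring, abs_mul,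
      abs_of_pos h]
  · rw [abs_of_nonpos (not_lt.1 h), show 1 / 2 * (b * (u + l) + -b * (u - l)) = b * l by ring,
      abs_mul, abs_of_nonpos (not_lt.1 h)]

/-- The weighted square integral of the upwind value splits over outflow and inflow parts. -/
theorem setIntegral_upwind_sq {s : Set X} {b u l : X → ℝ} (hb : MemLp b ⊤ (m.restrict s))
    (hu : MemLp u 2 (m.restrict s)) (hl : MemLp l 2 (m.restrict s)) :
    ∫ x in s, |b x| * upwind (b x) (u x) (l x) ^ 2 ∂m
      = (∫ x in s ∩ {x | 0 < b x}, |b x| * u x ^ 2 ∂m)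
        + ∫ x in s ∩ {x | b x ≤ 0}, |b x| * l x ^ 2 ∂m := by
  have hbm : AEMeasurable b (m.restrict s) := hb.aemeasurable
  have hA : NullMeasurableSet {x | 0 < b x} (m.restrict s) :=
    nullMeasurableSet_lt aemeasurable_const hbm
  have hAc : {x | b x ≤ 0} = {x | 0 < b x}ᶜ := by ext x; simp
  have hint : Integrable (fun x => |b x| * upwind (b x) (u x) (l x) ^ 2) (m.restrict s) := by
    have := (memLp_sqrt_abs_mul hb (memLp_upwind hbm hu hl)).integrable_sq
    simpa only [sqrt_abs_mul_sq] using this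
  rw [← integral_add_compl₀ hA hint, inter_comm s, inter_comm s, hAc,
    ← Measure.restrict_restrict₀ hA, ← Measure.restrict_restrict₀ hA.compl]
  congr 1
  · refine integral_congr_ae ?_
    filter_upwards [ae_restrict_mem₀ hA] with x hx
    have hx' : 0 < b x := hx
    simp only [upwind, if_pos hx']
  · refine integral_congr_ae ?_
    filter_upwards [ae_restrict_mem₀ hA.compl] with x hx
    have hx' : ¬ 0 < b x := hx
    simp only [upwind, if_neg hx']

end CauchySchwarz

/-! ### Splitting the norms into element contributions. -/

namespace Mesh

variable {d : ℕ} {D : Domain d}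

theorem Δt_pos (T : Mesh D) : 0 < T.Δt :=
  div_pos (sub_pos.2 D.lt) (Nat.cast_pos.2 T.N_pos)

theorem isOpen_carrier (T : Mesh D) (k : Fin T.numElem) : IsOpen (T.K k).carrier :=
  (T.K k).isOpen_carrier T.Δt_pos

/-- The part of `|||(v, μ)|||_s²` that belongs to the element `k`. -/
noncomputable def locS (T : Mesh D) (βbar : SpaceTime d → EuclideanSpace ℝ (Fin d)) (ν : ℝ)
    (v μ : SpaceTime d → ℝ) (k : Fin T.numElem) : ℝ :=
  (∫ z in (T.K k).carrier, v z ^ 2)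
  + (∫ z in frontier (T.K k).carrier ∩ D.bdryN, |T.bn βbar k z| * μ z ^ 2 ∂(surf d))
  + (∫ z in frontier (T.K k).carrier, |T.bn βbar k z| * (T.tr k v z - μ z) ^ 2 ∂(surf d))
  + (ν * ∫ z in (T.K k).carrier, ‖spatial (T.grad k v z)‖ ^ 2)
  + (ν / (T.K k).hK * ∫ z in (T.K k).Q, (T.tr k v z - μ z) ^ 2 ∂(surf d))
  + T.Δt * (T.K k).hK ^ 2 / (T.Δt + (T.K k).hK) * ∫ z in (T.K k).carrier, (T.grad k v z 0) ^ 2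

/-- The part of `|||(v, μ)|||_{s,⋆}²` that belongs to the element `k`. -/
noncomputable def locStar (T : Mesh D) (βbar : SpaceTime d → EuclideanSpace ℝ (Fin d)) (ν : ℝ)
    (v μ : SpaceTime d → ℝ) (k : Fin T.numElem) : ℝ :=
  T.locS βbar ν v μ k
  + (∫ z in frontier (T.K k).carrier ∩ {z | 0 < T.bn βbar k z},
      |T.bn βbar k z| * T.tr k v z ^ 2 ∂(surf d))
  + (∫ z in frontier (T.K k).carrier ∩ {z | T.bn βbar k z ≤ 0},
      |T.bn βbar k z| * μ z ^ 2 ∂(surf d))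
  + ((T.K k).hK * ν * ∫ z in (T.K k).Q, T.normalDeriv k v z ^ 2 ∂(surf d))
  + (T.Δt + (T.K k).hK) / (T.Δt * (T.K k).hK ^ 2) * ∫ z in (T.K k).carrier, v z ^ 2

theorem sum_integral_sq_le (T : Mesh D) {v : SpaceTime d → ℝ}
    (hv : MemLp v 2 (volume.restrict D.E)) :
    ∑ k, ∫ z in (T.K k).carrier, v z ^ 2 ≤ ∫ z in D.E, v z ^ 2 := by
  have hi : IntegrableOn (fun z => v z ^ 2) D.E := hv.integrable_sq
  rw [← integral_iUnion_fintype (fun k => (T.isOpen_carrier k).measurableSet) T.disjoint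
    fun k => hi.mono_set (T.subset k)]
  exact setIntegral_mono_set hi (Eventually.of_forall fun z => sq_nonneg _)
    (iUnion_subset T.subset).eventuallyLE

/-- Only the `L²` term differs, being an integral over all of `ℰ`. Disjointness of the elements
gives the inequality, so no statement about the measure of the skeleton is required. -/
theorem sum_locS_le (T : Mesh D) (βbar : SpaceTime d → EuclideanSpace ℝ (Fin d)) (ν : ℝ)
    {v : SpaceTime d → ℝ} (μ : SpaceTime d → ℝ) (hv : MemLp v 2 (volume.restrict D.E)) :
    ∑ k, T.locS βbar ν v μ k ≤ T.normSSq βbar ν v μ := by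
  have := T.sum_integral_sq_le hv
  unfold locS normSSq normVSq
  simp only [Finset.sum_add_distrib]
  linarith

theorem sum_locStar_le (T : Mesh D) (βbar : SpaceTime d → EuclideanSpace ℝ (Fin d)) (ν : ℝ)
    {v : SpaceTime d → ℝ} (μ : SpaceTime d → ℝ) (hv : MemLp v 2 (volume.restrict D.E)) :
    ∑ k, T.locStar βbar ν v μ k ≤ T.normSStarSq βbar ν v μ := by
  have := T.sum_locS_le βbar ν μ hv
  unfold locStar normSStarSq
  simp only [Finset.sum_add_distrib]
  linarith

theorem weight_nonneg (T : Mesh D) (k : Fin T.numElem) : 0 ≤ T.Δt * (T.K k).hK ^ 2 / (T.Δt + (T.K k).hK) := by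
  have := T.Δt_pos
  have := (T.K k).hK_nonneg
  positivity

theorem weight_pos (T : Mesh D) (k : Fin T.numElem) (hd : 1 ≤ d) : 0 < T.Δt * (T.K k).hK ^ 2 / (T.Δt + (T.K k).hK) := by
  have := T.Δt_pos
  have := (T.K k).hK_pos hd
  positivity

theorem locS_bounds (T : Mesh D) (βbar : SpaceTime d → EuclideanSpace ℝ (Fin d)) {ν : ℝ}
    (hν : 0 < ν) (v μ : SpaceTime d → ℝ) (k : Fin T.numElem) :
    0 ≤ T.locS βbar ν v μ k ∧
    (∫ z in (T.K k).carrier, v z ^ 2) ≤ T.locS βbar ν v μ k ∧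
    (∫ z in frontier (T.K k).carrier ∩ D.bdryN, |T.bn βbar k z| * μ z ^ 2 ∂(surf d))
      ≤ T.locS βbar ν v μ k ∧
    (∫ z in frontier (T.K k).carrier, |T.bn βbar k z| * (T.tr k v z - μ z) ^ 2 ∂(surf d))
      ≤ T.locS βbar ν v μ k ∧
    (ν * ∫ z in (T.K k).carrier, ‖spatial (T.grad k v z)‖ ^ 2) ≤ T.locS βbar ν v μ k ∧
    (ν / (T.K k).hK * ∫ z in (T.K k).Q, (T.tr k v z - μ z) ^ 2 ∂(surf d))
      ≤ T.locS βbar ν v μ k ∧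
    (T.Δt * (T.K k).hK ^ 2 / (T.Δt + (T.K k).hK) * ∫ z in (T.K k).carrier, (T.grad k v z 0) ^ 2)
      ≤ T.locS βbar ν v μ k := by
  have hw := T.weight_nonneg k
  have hh := (T.K k).hK_nonneg
  have h1 : 0 ≤ ∫ z in (T.K k).carrier, v z ^ 2 := integral_nonneg fun z => by positivity
  have h2 : 0 ≤ ∫ z in frontier (T.K k).carrier ∩ D.bdryN, |T.bn βbar k z| * μ z ^ 2 ∂(surf d) :=
    integral_nonneg fun z => by positivity
  have h3 : 0 ≤ ∫ z in frontier (T.K k).carrier,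
      |T.bn βbar k z| * (T.tr k v z - μ z) ^ 2 ∂(surf d) := integral_nonneg fun z => by positivity
  have h4 : 0 ≤ ν * ∫ z in (T.K k).carrier, ‖spatial (T.grad k v z)‖ ^ 2 :=
    mul_nonneg hν.le (integral_nonneg fun z => by positivity)
  have h5 : 0 ≤ ν / (T.K k).hK * ∫ z in (T.K k).Q, (T.tr k v z - μ z) ^ 2 ∂(surf d) :=
    mul_nonneg (by positivity) (integral_nonneg fun z => by positivity)
  have h6 : 0 ≤ T.Δt * (T.K k).hK ^ 2 / (T.Δt + (T.K k).hK) *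
      ∫ z in (T.K k).carrier, (T.grad k v z 0) ^ 2 :=
    mul_nonneg hw (integral_nonneg fun z => by positivity)
  unfold locS
  refine ⟨?_, ?_, ?_, ?_, ?_, ?_, ?_⟩ <;> linarith

theorem locStar_bounds (T : Mesh D) (βbar : SpaceTime d → EuclideanSpace ℝ (Fin d)) {ν : ℝ}
    (hν : 0 < ν) (v μ : SpaceTime d → ℝ) (k : Fin T.numElem) :
    T.locS βbar ν v μ k ≤ T.locStar βbar ν v μ k ∧
    ((∫ z in frontier (T.K k).carrier ∩ {z | 0 < T.bn βbar k z},
        |T.bn βbar k z| * T.tr k v z ^ 2 ∂(surf d))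
      + ∫ z in frontier (T.K k).carrier ∩ {z | T.bn βbar k z ≤ 0},
        |T.bn βbar k z| * μ z ^ 2 ∂(surf d)) ≤ T.locStar βbar ν v μ k ∧
    ((T.K k).hK * ν * ∫ z in (T.K k).Q, T.normalDeriv k v z ^ 2 ∂(surf d))
      ≤ T.locStar βbar ν v μ k ∧
    ((T.Δt + (T.K k).hK) / (T.Δt * (T.K k).hK ^ 2) * ∫ z in (T.K k).carrier, v z ^ 2)
      ≤ T.locStar βbar ν v μ k := by
  have hh := (T.K k).hK_nonneg
  have hΔ := T.Δt_pos
  have h0 := (T.locS_bounds βbar hν v μ k).1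
  have h1 : 0 ≤ ∫ z in frontier (T.K k).carrier ∩ {z | 0 < T.bn βbar k z},
        |T.bn βbar k z| * T.tr k v z ^ 2 ∂(surf d) := integral_nonneg fun z => by positivity
  have h2 : 0 ≤ ∫ z in frontier (T.K k).carrier ∩ {z | T.bn βbar k z ≤ 0},
        |T.bn βbar k z| * μ z ^ 2 ∂(surf d) := integral_nonneg fun z => by positivity
  have h3 : 0 ≤ (T.K k).hK * ν * ∫ z in (T.K k).Q, T.normalDeriv k v z ^ 2 ∂(surf d) :=
    mul_nonneg (by positivity) (integral_nonneg fun z => by positivity)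
  have h4 : 0 ≤ (T.Δt + (T.K k).hK) / (T.Δt * (T.K k).hK ^ 2) *
      ∫ z in (T.K k).carrier, v z ^ 2 :=
    mul_nonneg (by positivity) (integral_nonneg fun z => by positivity)
  unfold locStar
  refine ⟨?_, ?_, ?_, ?_⟩ <;> linarith

theorem abs_sum_le_of_local (T : Mesh D) (βbar : SpaceTime d → EuclideanSpace ℝ (Fin d)) {ν : ℝ}
    (hν : 0 < ν) {u lam v μ : SpaceTime d → ℝ} (hu : MemLp u 2 (volume.restrict D.E))
    (hv : MemLp v 2 (volume.restrict D.E)) {c : ℝ} (hc : 0 ≤ c) {t : Fin T.numElem → ℝ}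
    (ht : ∀ k, |t k| ≤
      c * (Real.sqrt (T.locStar βbar ν u lam k) * Real.sqrt (T.locS βbar ν v μ k))) :
    |∑ k, t k| ≤ c * (T.normSStar βbar ν u lam * T.normS βbar ν v μ) := by
  calc |∑ k, t k| ≤ ∑ k, |t k| := Finset.abs_sum_le_sum_abs _ _
    _ ≤ ∑ k, c * (Real.sqrt (T.locStar βbar ν u lam k) * Real.sqrt (T.locS βbar ν v μ k)) :=
        Finset.sum_le_sum fun k _ => ht k
    _ = c * ∑ k, Real.sqrt (T.locStar βbar ν u lam k) * Real.sqrt (T.locS βbar ν v μ k) := by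
        rw [Finset.mul_sum]
    _ ≤ c * (Real.sqrt (∑ k, T.locStar βbar ν u lam k) *
          Real.sqrt (∑ k, T.locS βbar ν v μ k)) := by
        refine mul_le_mul_of_nonneg_left (Real.sum_sqrt_mul_sqrt_le _ (fun k => ?_) fun k => ?_) hc
        · exact (T.locS_bounds βbar hν u lam k).1.trans (T.locStar_bounds βbar hν u lam k).1
        · exact (T.locS_bounds βbar hν v μ k).1
    _ ≤ _ := by
        refine mul_le_mul_of_nonneg_left (mul_le_mul ?_ ?_ (Real.sqrt_nonneg _)
          (Real.sqrt_nonneg _)) hc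
        · exact Real.sqrt_le_sqrt (T.sum_locStar_le βbar ν lam hu)
        · exact Real.sqrt_le_sqrt (T.sum_locS_le βbar ν μ hv)

end Mesh

theorem sqrt_mul_sqrt_mono {a b x y : ℝ} (ha : a ≤ x) (hb : b ≤ y) :
    Real.sqrt a * Real.sqrt b ≤ Real.sqrt x * Real.sqrt y :=
  mul_le_mul (Real.sqrt_le_sqrt ha) (Real.sqrt_le_sqrt hb) (Real.sqrt_nonneg _)
    (Real.sqrt_nonneg _)

/-- Inserts a weight into one factor and its inverse into the other, to match the weights of the two
norms. -/
theorem sqrt_mul_sqrt_scale {c : ℝ} (hc : 0 < c) (a b : ℝ) :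
    Real.sqrt a * Real.sqrt b = Real.sqrt (c⁻¹ * a) * Real.sqrt (c * b) := by
  rw [Real.sqrt_mul (inv_nonneg.2 hc.le), Real.sqrt_mul hc.le, Real.sqrt_inv]
  have := (Real.sqrt_pos.2 hc).ne'
  field_simp

theorem mul_sqrt_mul_sqrt {c : ℝ} (hc : 0 ≤ c) (a b : ℝ) :
    c * (Real.sqrt a * Real.sqrt b) = Real.sqrt (c * a) * Real.sqrt (c * b) := by
  rw [Real.sqrt_mul hc, Real.sqrt_mul hc]
  nth_rewrite 1 [← Real.mul_self_sqrt hc]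
  ring

theorem MemVh.memLp {d : ℕ} {D : Domain d} {T : Mesh D} {pt ps : ℕ} {v : SpaceTime d → ℝ}
    (hv : MemVh T pt ps v) : MemLp v 2 (volume.restrict D.E) := hv.1

theorem MemVExt.memLp {d : ℕ} {D : Domain d} {T : Mesh D} {pt ps : ℕ} {u : SpaceTime d → ℝ}
    (hu : MemVExt T pt ps u) : MemLp u 2 (volume.restrict D.E) := by
  obtain ⟨v, w, hv, ⟨g, hg, -⟩, rfl⟩ := hu
  exact hv.1.add hg.1

theorem MemMh.memLp {d : ℕ} {D : Domain d} {T : Mesh D} {pt ps : ℕ} {μ : SpaceTime d → ℝ}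
    (hμ : MemMh T pt ps μ) (k : Fin T.numElem) :
    MemLp μ 2 ((surf d).restrict (frontier (T.K k).carrier)) :=
  hμ.1.mono_measure (Measure.restrict_mono
    (subset_iUnion (fun k => frontier (T.K k).carrier) k) le_rfl)

theorem MemMExt.memLp {d : ℕ} {D : Domain d} {T : Mesh D} {pt ps : ℕ} {lam : SpaceTime d → ℝ}
    (hl : MemMExt T pt ps lam) (k : Fin T.numElem) :
    MemLp lam 2 ((surf d).restrict (frontier (T.K k).carrier)) := by
  obtain ⟨μ, ξ, hμ, ⟨w, -, hw⟩, rfl⟩ := hl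
  exact (hμ.memLp k).add (hw k).2.1

theorem ae_norm_le_of_eLpNorm_top_le {X E : Type*} [MeasurableSpace X] [NormedAddCommGroup E]
    {m : Measure X} {f : X → E} {B : ℝ} (h : eLpNorm f ⊤ m ≤ ENNReal.ofReal B) :
    ∀ᵐ x ∂m, ‖f x‖ ≤ max B 0 := by
  rw [eLpNorm_exponent_top] at h
  filter_upwards [ae_le_eLpNormEssSup (f := f) (μ := m)] with x hx
  have h1 := hx.trans h
  rw [← ofReal_norm, ENNReal.ofReal_le_ofReal_iff'] at h1
  rcases h1 with h1 | h1
  · exact h1.trans (le_max_left _ _)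
  · exact h1.trans (le_max_right _ _)

/-! ### Local bounds for the six terms of the form. -/

namespace Mesh

variable {d : ℕ} {D : Domain d}

theorem bn_memLp (T : Mesh D) (βbar : SpaceTime d → EuclideanSpace ℝ (Fin d))
    (k : Fin T.numElem) :
    MemLp (T.bn βbar k) ⊤ ((surf d).restrict (frontier (T.K k).carrier)) :=
  normalTrace_memLp _ _

theorem tr_memLp (T : Mesh D) (k : Fin T.numElem) (u : SpaceTime d → ℝ) :
    MemLp (T.tr k u) 2 ((surf d).restrict (frontier (T.K k).carrier)) :=
  trace_memLp _ _

theorem restrict_Q_le (T : Mesh D) (k : Fin T.numElem) :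
    (surf d).restrict (T.K k).Q ≤ (surf d).restrict (frontier (T.K k).carrier) :=
  Measure.restrict_mono inter_subset_left le_rfl

theorem abs_integral_advection_le (T : Mesh D) {βbar : SpaceTime d → EuclideanSpace ℝ (Fin d)}
    {ν B : ℝ} (hν : 0 < ν) (hd : 1 ≤ d) (hB : 0 ≤ B)
    (hβ : ∀ᵐ z ∂(volume.restrict D.E), ‖βbar z‖ ≤ B) {u : SpaceTime d → ℝ}
    (lam v μ : SpaceTime d → ℝ) (hu : MemLp u 2 (volume.restrict D.E)) (k : Fin T.numElem) :
    |∫ z in (T.K k).carrier, u z * inner ℝ (stField βbar z) (T.grad k v z)| ≤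
      (1 + B * Real.sqrt ν⁻¹) *
        (Real.sqrt (T.locStar βbar ν u lam k) * Real.sqrt (T.locS βbar ν v μ k)) := by
  set m := volume.restrict (T.K k).carrier
  have hm : m ≤ volume.restrict D.E := Measure.restrict_mono (T.subset k) le_rfl
  have hu' : MemLp u 2 m := hu.mono_measure hm
  have hg0 : MemLp (fun z => T.grad k v z 0) 2 m := weakGrad_coord_memLp _ v 0
  have hgs : MemLp (fun z => ‖spatial (T.grad k v z)‖) 2 m := (spatial_weakGrad_memLp _ v).norm
  have hi1 := integrable_abs_mul_abs hu' hg0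
  have hi2 := (integrable_abs_mul_abs hu' hgs).const_mul B
  obtain ⟨-, -, -, -, hS4, -, hS6⟩ := T.locS_bounds βbar hν v μ k
  obtain ⟨hX0, hX1, -⟩ := T.locS_bounds βbar hν u lam k
  obtain ⟨hst, -, -, hst4⟩ := T.locStar_bounds βbar hν u lam k
  have hw := T.weight_pos k hd
  have h1 : |∫ z in (T.K k).carrier, u z * inner ℝ (stField βbar z) (T.grad k v z)| ≤
      ∫ z, (|u z| * |T.grad k v z 0| + B * (|u z| * |‖spatial (T.grad k v z)‖|)) ∂m := by
    rw [← Real.norm_eq_abs]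
    refine norm_integral_le_of_norm_le (hi1.add hi2) ?_
    filter_upwards [ae_mono hm hβ] with z hz
    rw [stField, inner_mkST, one_mul, Real.norm_eq_abs, abs_mul, abs_norm]
    calc |u z| * |T.grad k v z 0 + inner ℝ (βbar z) (spatial (T.grad k v z))|
        ≤ |u z| * (|T.grad k v z 0| + B * ‖spatial (T.grad k v z)‖) := by
          refine mul_le_mul_of_nonneg_left ((abs_add_le _ _).trans (add_le_add_right ?_ _))
            (abs_nonneg _)
          exact (abs_real_inner_le_norm _ _).trans
            (mul_le_mul_of_nonneg_right hz (norm_nonneg _))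
      _ = _ := by ring
  rw [integral_add hi1 hi2, integral_const_mul] at h1
  have h2 := integral_abs_mul_abs_le hu' hg0
  have h3 := integral_abs_mul_abs_le hu' hgs
  -- The inverse of the weight of `∂ₜv` is exactly the weight of `‖u‖²` in the last term of the
  -- starred norm.
  rw [sqrt_mul_sqrt_scale hw, inv_div] at h2
  have h2' := h2.trans (sqrt_mul_sqrt_mono hst4 hS6)
  -- The factor `√ν` is needed for `‖∇̄v‖`; its inverse goes into the constant, and `u` uses the
  -- unweighted `L²` term.
  rw [sqrt_mul_sqrt_scale hν, Real.sqrt_mul (inv_nonneg.2 hν.le), mul_assoc] at h3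
  have h3' := h3.trans (mul_le_mul_of_nonneg_left
    (sqrt_mul_sqrt_mono (hX1.trans hst) hS4) (Real.sqrt_nonneg _))
  have h4 := mul_le_mul_of_nonneg_left h3' hB
  linarith

theorem abs_integral_bdryN_le (T : Mesh D) (βbar : SpaceTime d → EuclideanSpace ℝ (Fin d))
    {ν : ℝ} (hν : 0 < ν) (u v : SpaceTime d → ℝ) {lam μ : SpaceTime d → ℝ} (k : Fin T.numElem)
    (hl : MemLp lam 2 ((surf d).restrict (frontier (T.K k).carrier)))
    (hμ : MemLp μ 2 ((surf d).restrict (frontier (T.K k).carrier))) :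
    |∫ z in frontier (T.K k).carrier ∩ D.bdryN,
      1 / 2 * (T.bn βbar k z + |T.bn βbar k z|) * lam z * μ z ∂(surf d)| ≤
      1 * (Real.sqrt (T.locStar βbar ν u lam k) * Real.sqrt (T.locS βbar ν v μ k)) := by
  have hle : (surf d).restrict (frontier (T.K k).carrier ∩ D.bdryN) ≤
      (surf d).restrict (frontier (T.K k).carrier) :=
    Measure.restrict_mono inter_subset_left le_rfl
  have hb := T.bn_memLp βbar k
  have h := abs_integral_le_sqrt_mul_sqrt
    (F := fun z => 1 / 2 * (T.bn βbar k z + |T.bn βbar k z|) * lam z * μ z)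
    ((memLp_sqrt_abs_mul hb hl).mono_measure hle) ((memLp_sqrt_abs_mul hb hμ).mono_measure hle)
    (Eventually.of_forall fun z => by
      set b := T.bn βbar k z
      have hb1 : |1 / 2 * (b + |b|)| ≤ |b| := by
        rw [abs_le]
        constructor <;> linarith [neg_abs_le b, le_abs_self b]
      rw [abs_mul, abs_mul, abs_mul (Real.sqrt |b|), abs_mul (Real.sqrt |b|),
        abs_of_nonneg (Real.sqrt_nonneg _)]
      calc |1 / 2 * (b + |b|)| * |lam z| * |μ z| ≤ |b| * |lam z| * |μ z| := by gcongr
        _ = Real.sqrt |b| * Real.sqrt |b| * |lam z| * |μ z| := by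
            rw [Real.mul_self_sqrt (abs_nonneg b)]
        _ ≤ _ := le_of_eq (by ring))
  simp only [sqrt_abs_mul_sq] at h
  rw [one_mul]
  exact h.trans (sqrt_mul_sqrt_mono
    ((T.locS_bounds βbar hν u lam k).2.2.1.trans (T.locStar_bounds βbar hν u lam k).1)
    (T.locS_bounds βbar hν v μ k).2.2.1)

theorem abs_integral_upwind_le (T : Mesh D) (βbar : SpaceTime d → EuclideanSpace ℝ (Fin d))
    {ν : ℝ} (hν : 0 < ν) (u v : SpaceTime d → ℝ) {lam μ : SpaceTime d → ℝ} (k : Fin T.numElem)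
    (hl : MemLp lam 2 ((surf d).restrict (frontier (T.K k).carrier)))
    (hμ : MemLp μ 2 ((surf d).restrict (frontier (T.K k).carrier))) :
    |∫ z in frontier (T.K k).carrier,
      1 / 2 * (T.bn βbar k z * (T.tr k u z + lam z) + |T.bn βbar k z| * (T.tr k u z - lam z))
        * (T.tr k v z - μ z) ∂(surf d)| ≤
      1 * (Real.sqrt (T.locStar βbar ν u lam k) * Real.sqrt (T.locS βbar ν v μ k)) := by
  have hb := T.bn_memLp βbar k
  have hup := memLp_upwind hb.aemeasurable (T.tr_memLp k u) hl
  have hdf : MemLp (fun z => T.tr k v z - μ z) 2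
      ((surf d).restrict (frontier (T.K k).carrier)) := (T.tr_memLp k v).sub hμ
  have h := abs_integral_le_sqrt_mul_sqrt
    (F := fun z => 1 / 2 * (T.bn βbar k z * (T.tr k u z + lam z)
      + |T.bn βbar k z| * (T.tr k u z - lam z)) * (T.tr k v z - μ z))
    (memLp_sqrt_abs_mul hb hup) (memLp_sqrt_abs_mul hb hdf)
    (Eventually.of_forall fun z => by
      set b := T.bn βbar k z
      rw [abs_mul, upwind_flux, abs_mul (Real.sqrt |b|), abs_mul (Real.sqrt |b|),
        abs_of_nonneg (Real.sqrt_nonneg _)]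
      nth_rewrite 1 [← Real.mul_self_sqrt (abs_nonneg b)]
      exact le_of_eq (by ring))
  simp only [sqrt_abs_mul_sq] at h
  -- The upwind square is the sum of the outflow term in `u` and the inflow term in `λ`, which the
  -- starred norm contains.
  rw [setIntegral_upwind_sq hb (T.tr_memLp k u) hl] at h
  rw [one_mul]
  exact h.trans (sqrt_mul_sqrt_mono (T.locStar_bounds βbar hν u lam k).2.1
    (T.locS_bounds βbar hν v μ k).2.2.2.1)

theorem abs_integral_grad_le (T : Mesh D) (βbar : SpaceTime d → EuclideanSpace ℝ (Fin d))
    {ν : ℝ} (hν : 0 < ν) (u lam v μ : SpaceTime d → ℝ) (k : Fin T.numElem) :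
    |∫ z in (T.K k).carrier, ν * inner ℝ (spatial (T.grad k u z)) (spatial (T.grad k v z))| ≤
      1 * (Real.sqrt (T.locStar βbar ν u lam k) * Real.sqrt (T.locS βbar ν v μ k)) := by
  rw [integral_const_mul, abs_mul, abs_of_pos hν]
  have h := abs_integral_le_sqrt_mul_sqrt
    (F := fun z => inner ℝ (spatial (T.grad k u z)) (spatial (T.grad k v z)))
    (spatial_weakGrad_memLp (T.K k).carrier u).norm (spatial_weakGrad_memLp (T.K k).carrier v).norm
    (Eventually.of_forall fun z => by
      rw [abs_norm, abs_norm]; exact abs_real_inner_le_norm _ _)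
  have h1 := mul_le_mul_of_nonneg_left h hν.le
  rw [mul_sqrt_mul_sqrt hν.le] at h1
  rw [one_mul]
  exact h1.trans (sqrt_mul_sqrt_mono
    ((T.locS_bounds βbar hν u lam k).2.2.2.2.1.trans (T.locStar_bounds βbar hν u lam k).1)
    (T.locS_bounds βbar hν v μ k).2.2.2.2.1)

theorem abs_integral_penalty_le (T : Mesh D) (βbar : SpaceTime d → EuclideanSpace ℝ (Fin d))
    {ν α : ℝ} (hν : 0 < ν) (hα : 0 < α) (u v : SpaceTime d → ℝ) {lam μ : SpaceTime d → ℝ}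
    (k : Fin T.numElem) (hl : MemLp lam 2 ((surf d).restrict (frontier (T.K k).carrier)))
    (hμ : MemLp μ 2 ((surf d).restrict (frontier (T.K k).carrier))) :
    |∫ z in (T.K k).Q,
      ν * α / (T.K k).hK * (T.tr k u z - lam z) * (T.tr k v z - μ z) ∂(surf d)| ≤
      α * (Real.sqrt (T.locStar βbar ν u lam k) * Real.sqrt (T.locS βbar ν v μ k)) := by
  have hh := (T.K k).hK_nonneg
  have hc : 0 ≤ ν / (T.K k).hK := by positivity
  have h := abs_integral_le_sqrt_mul_sqrt
    (F := fun z => (T.tr k u z - lam z) * (T.tr k v z - μ z))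
    (((T.tr_memLp k u).sub hl).mono_measure (T.restrict_Q_le k))
    (((T.tr_memLp k v).sub hμ).mono_measure (T.restrict_Q_le k))
    (Eventually.of_forall fun z => (abs_mul _ _).le)
  simp only [Pi.sub_apply] at h
  have h1 := mul_le_mul_of_nonneg_left h hc
  rw [mul_sqrt_mul_sqrt hc] at h1
  have h2 := h1.trans (sqrt_mul_sqrt_mono
    ((T.locS_bounds βbar hν u lam k).2.2.2.2.2.1.trans (T.locStar_bounds βbar hν u lam k).1)
    (T.locS_bounds βbar hν v μ k).2.2.2.2.2.1)
  have h3 : ∫ z in (T.K k).Q,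
      ν * α / (T.K k).hK * (T.tr k u z - lam z) * (T.tr k v z - μ z) ∂(surf d)
      = α * (ν / (T.K k).hK * ∫ z in (T.K k).Q,
        (T.tr k u z - lam z) * (T.tr k v z - μ z) ∂(surf d)) := by
    rw [← integral_const_mul, ← integral_const_mul]
    congr 1
    ext z
    ring
  rw [h3, abs_mul, abs_mul, abs_of_pos hα, abs_of_nonneg hc]
  exact mul_le_mul_of_nonneg_left h2 hα.le

theorem abs_integral_consistency_le (T : Mesh D)
    (βbar : SpaceTime d → EuclideanSpace ℝ (Fin d)) {ν C : ℝ} (hν : 0 < ν) (hd : 1 ≤ d)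
    (hC : 0 ≤ C) (u v : SpaceTime d → ℝ) {lam μ : SpaceTime d → ℝ}
    (k : Fin T.numElem) (hl : MemLp lam 2 ((surf d).restrict (frontier (T.K k).carrier)))
    (hμ : MemLp μ 2 ((surf d).restrict (frontier (T.K k).carrier)))
    (htrace : (T.K k).hK * ∫ z in (T.K k).Q, T.normalDeriv k v z ^ 2 ∂(surf d)
      ≤ C * ∫ z in (T.K k).carrier, ‖spatial (T.grad k v z)‖ ^ 2) :
    |∫ z in (T.K k).Q, (ν * (T.tr k u z - lam z) * T.normalDeriv k v z
        + ν * T.normalDeriv k u z * (T.tr k v z - μ z)) ∂(surf d)| ≤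
      (Real.sqrt C + 1) *
        (Real.sqrt (T.locStar βbar ν u lam k) * Real.sqrt (T.locS βbar ν v μ k)) := by
  have hh := (T.K k).hK_pos hd
  have hQ := T.restrict_Q_le k
  have hdu : MemLp (fun z => T.tr k u z - lam z) 2 ((surf d).restrict (T.K k).Q) :=
    ((T.tr_memLp k u).sub hl).mono_measure hQ
  have hdv : MemLp (fun z => T.tr k v z - μ z) 2 ((surf d).restrict (T.K k).Q) :=
    ((T.tr_memLp k v).sub hμ).mono_measure hQ
  have hnu : MemLp (T.normalDeriv k u) 2 ((surf d).restrict (T.K k).Q) :=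
    ((T.K k).normalDer_memLp u).mono_measure hQ
  have hnv : MemLp (T.normalDeriv k v) 2 ((surf d).restrict (T.K k).Q) :=
    ((T.K k).normalDer_memLp v).mono_measure hQ
  have hi1 := (integrable_abs_mul_abs hdu hnv).const_mul ν
  have hi2 := (integrable_abs_mul_abs hnu hdv).const_mul ν
  obtain ⟨-, -, -, -, hS4, hS5, -⟩ := T.locS_bounds βbar hν v μ k
  have hX5 := (T.locS_bounds βbar hν u lam k).2.2.2.2.2.1
  obtain ⟨hst, -, hst3, -⟩ := T.locStar_bounds βbar hν u lam k
  have h1 : |∫ z in (T.K k).Q, (ν * (T.tr k u z - lam z) * T.normalDeriv k v z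
        + ν * T.normalDeriv k u z * (T.tr k v z - μ z)) ∂(surf d)| ≤
      ∫ z in (T.K k).Q, (ν * (|T.tr k u z - lam z| * |T.normalDeriv k v z|)
        + ν * (|T.normalDeriv k u z| * |T.tr k v z - μ z|)) ∂(surf d) := by
    rw [← Real.norm_eq_abs]
    refine norm_integral_le_of_norm_le (hi1.add hi2) (Eventually.of_forall fun z => ?_)
    rw [Real.norm_eq_abs]
    refine (abs_add_le _ _).trans_eq ?_
    rw [abs_mul, abs_mul, abs_mul, abs_mul, abs_of_pos hν, mul_assoc, mul_assoc]
  rw [integral_add hi1 hi2, integral_const_mul, integral_const_mul] at h1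
  have h2 := mul_le_mul_of_nonneg_left (integral_abs_mul_abs_le hdu hnv) hν.le
  have h3 := mul_le_mul_of_nonneg_left (integral_abs_mul_abs_le hnu hdv) hν.le
  -- The jump takes the weight `h_K⁻¹` and the normal derivative `h_K`. For `v` the latter is
  -- absorbed by the trace inequality, giving `√C`; for `u` it is a term of the starred norm, giving
  -- `1`.
  rw [mul_sqrt_mul_sqrt hν.le, sqrt_mul_sqrt_scale hh] at h2
  rw [mul_sqrt_mul_sqrt hν.le, sqrt_mul_sqrt_scale (inv_pos.2 hh), inv_inv] at h3
  have hA : ∀ I : ℝ, (T.K k).hK⁻¹ * (ν * I) = ν / (T.K k).hK * I := fun I => by ring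
  rw [hA] at h2 h3
  have h2' : (T.K k).hK * (ν * ∫ z in (T.K k).Q, T.normalDeriv k v z ^ 2 ∂(surf d))
      ≤ C * T.locS βbar ν v μ k := by
    calc _ = ν * ((T.K k).hK * ∫ z in (T.K k).Q, T.normalDeriv k v z ^ 2 ∂(surf d)) := by ring
      _ ≤ ν * (C * ∫ z in (T.K k).carrier, ‖spatial (T.grad k v z)‖ ^ 2) :=
          mul_le_mul_of_nonneg_left htrace hν.le
      _ = C * (ν * ∫ z in (T.K k).carrier, ‖spatial (T.grad k v z)‖ ^ 2) := by ring
      _ ≤ _ := mul_le_mul_of_nonneg_left hS4 hC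
  have h4 := h2.trans (sqrt_mul_sqrt_mono (hX5.trans hst) h2')
  rw [← mul_assoc] at h3
  have h5 := h3.trans (sqrt_mul_sqrt_mono hst3 hS5)
  rw [Real.sqrt_mul hC] at h4
  linarith

end Mesh

end STHDG

/-! ### Summation of the six bounds. -/

theorem lemma4p2 (d : ℕ) (hd : 1 ≤ d) (pt ps : ℕ) (ν α : ℝ) (hν : 0 < ν) (hα : 0 < α)
    (B cr C₁ C₂ : ℝ) :
    ∃ cB : ℝ, 0 < cB ∧
      ∀ (D : STHDG.Domain d) (βbar : STHDG.SpaceTime d → EuclideanSpace ℝ (Fin d)),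
        STHDG.AdmissibleField D βbar →
        MeasureTheory.eLpNorm βbar ⊤ (MeasureTheory.volume.restrict D.E) ≤ ENNReal.ofReal B →
      ∀ T : STHDG.Mesh D, T.ShapeRegular cr → T.JacobianBounds C₁ C₂ →
      ∀ u lam v μ : STHDG.SpaceTime d → ℝ,
        STHDG.MemVExt T pt ps u → STHDG.MemMExt T pt ps lam →
        STHDG.MemVh T pt ps v → STHDG.MemMh T pt ps μ →
        |T.form βbar ν α u lam v μ| ≤ cB * T.normSStar βbar ν u lam * T.normS βbar ν v μ := by
  obtain ⟨C, hC, htrace⟩ := STHDG.Element.exists_trace_inequality hd pt ps C₁ C₂ cr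
  have hBs : 0 ≤ max B 0 * Real.sqrt ν⁻¹ := by positivity
  -- The summands belong, in order, to advection, Neumann boundary, upwind flux, diffusion, penalty
  -- and consistency. `max B 0` appears because `ENNReal.ofReal` truncates a negative `B` to `0`.
  refine ⟨(1 + max B 0 * Real.sqrt ν⁻¹) + 1 + 1 + 1 + α + (Real.sqrt C + 1), by positivity, ?_⟩
  intro D βbar _ hβ T hcr hJ u lam v μ hu hlam hv hμ
  have hβ' := STHDG.ae_norm_le_of_eLpNorm_top_le hβ
  have hsum := fun {c : ℝ} (hc : 0 ≤ c) {t : Fin T.numElem → ℝ} =>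
    T.abs_sum_le_of_local (lam := lam) (μ := μ) (t := t) βbar hν hu.memLp hv.memLp hc
  have h1 := hsum (by positivity) fun k =>
    T.abs_integral_advection_le hν hd (le_max_right B 0) hβ' lam v μ hu.memLp k
  have h2 := hsum zero_le_one fun k =>
    T.abs_integral_bdryN_le βbar hν u v k (hlam.memLp k) (hμ.memLp k)
  have h3 := hsum zero_le_one fun k =>
    T.abs_integral_upwind_le βbar hν u v k (hlam.memLp k) (hμ.memLp k)
  have h4 := hsum zero_le_one fun k => T.abs_integral_grad_le βbar hν u lam v μ k
  have h5 := hsum hα.le fun k =>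
    T.abs_integral_penalty_le βbar hν hα u v k (hlam.memLp k) (hμ.memLp k)
  have h6 := hsum (by positivity) fun k =>
    T.abs_integral_consistency_le βbar hν hd hC u v k (hlam.memLp k) (hμ.memLp k)
      (htrace _ (T.K k) T.Δt_pos (hJ k) (hcr k) v (hv.2 k))
  unfold STHDG.Mesh.form STHDG.Mesh.formA STHDG.Mesh.formD
  set N := T.normSStar βbar ν u lam * T.normS βbar ν v μ
  rw [mul_assoc]
  rw [abs_le] at h1 h2 h3 h4 h5 h6 ⊢
  constructor <;> linarith [h1.1, h1.2, h2.1, h2.2, h3.1, h3.2, h4.1, h4.2, h5.1, h5.2, h6.1, h6.2]
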